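/- Let $(W,S)$ be a Coxeter system with $S$ finite, and let $M\subseteq S$ be such that the connected components of the Coxeter diagram of $(W,S)$ containing no element of $M$ generate a finite subgroup of $W$ (for instance, $M$ meets every connected component). For $J\subseteq S$ write $W_J=\langle J\rangle$. Let $\mathcal P_{W,M}$ be the associated Wythoffian polytope, viewed as an abstract polytope: its vertices are the points of the $W$-orbit of a base point $x_0$ that lies on the walls of the fundamental chamber belonging to $S\setminus M$ and on no other wall of it (so that $x_0$ has stabilizer $W_{S\setminus M}$, and the vertex set is $W/W_{S\setminus M}$); its faces, given by their vertex sets and ordered by inclusion, are the empty face and the sets $wW_Jx_0$ for $w\in W$ and $J\subseteq S$. The link of a vertex $v$ is the section of $\mathcal P_{W,M}$ consisting of all faces that contain $v$. The $1$-skeleton $X$ of $\mathcal P_{W,M}$ is the graph on the vertices in which $wx_0$ is joined to $wsx_0$ whenever $w\in W$, $s\in S$ and $wx_0\neq wsx_0$. The vertices of the Cayley graph $\mathrm{Cay}(W,S)$ are the elements of $W$, identified with the chambers of the Coxeter complex; $w$ is adjacent to $ws$ for $s\in S$. Write $d_X$ and $d_S$ for the geodesic distances of $X$ and $\mathrm{Cay}(W,S)$.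 Then $X$ and $\mathrm{Cay}(W,S)$ are quasi-isometric if and only if $\mathcal P_{W,M}$ has finite vertex links, that is, the link of every vertex is finite. In that case, the natural map $f:\mathrm{Cay}(W,S)\to X$, $f(w)=wx_0$, which sends a chamber to the unique vertex of $\mathcal P_{W,M}$ that it contains, is surjective, $W$-equivariant and a quasi-isometry; moreover $W_{S\setminus M}$ has an element of maximal length and, if $D$ denotes this maximal length, then for all $w,w'\in W$ $$d_X(f(w),f(w'))\le d_S(w,w')\le (D+1)\,d_X(f(w),f(w'))+D .$$ Here a map $f:(Y,d_Y)\to(Z,d_Z)$ of metric spaces is a quasi-isometry if there are constants $A\ge1$, $B,C\ge0$ such that $A^{-1}d_Y(y,y')-A^{-1}B\le d_Z(f(y),f(y'))\le A\,d_Y(y,y')+B$ for all $y,y'\in Y$ and every point of $Z$ lies at distance at most $C$ from $f(Y)$; the spaces are quasi-isometric if such a map exists. -/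

import Mathlib

namespace Wythoff

section GraphQuasiIsometry

variable {V V' : Type*}

/-- A map between the vertex sets of two (connected) graphs is a quasi-isometry for the geodesic
distances of the graphs. -/
def IsQuasiIsometry (G : SimpleGraph V) (H : SimpleGraph V') (f : V → V') : Prop :=
  ∃ a b c : ℝ, 1 ≤ a ∧ 0 ≤ b ∧ 0 ≤ c ∧
    (∀ x x' : V, a⁻¹ * (G.dist x x' : ℝ) - a⁻¹ * b ≤ (H.dist (f x) (f x') : ℝ) ∧
      (H.dist (f x) (f x') : ℝ) ≤ a * (G.dist x x' : ℝ) + b) ∧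
    ∀ y : V', ∃ x : V, (H.dist y (f x) : ℝ) ≤ c

/-- Two (connected) graphs are quasi-isometric. -/
def QuasiIsometric (G : SimpleGraph V) (H : SimpleGraph V') : Prop :=
  ∃ f : V → V', IsQuasiIsometry G H f

end GraphQuasiIsometry

/-- The (unlabelled) Coxeter diagram: `s` and `t` are joined when `m s t ≥ 3`, including
`m s t = ∞`, which Mathlib encodes as `0`. -/
def coxeterDiagram {B : Type*} (A : CoxeterMatrix B) : SimpleGraph B where
  Adj s t := s ≠ t ∧ A s t ≠ 2
  symm := ⟨fun s t h => ⟨h.1.symm, by rw [A.symmetric]; exact h.2⟩⟩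
  loopless := ⟨fun _ h => h.1 rfl⟩

variable {B W : Type*} [Group W] {A : CoxeterMatrix B}

/-- The standard parabolic subgroup `W_J` generated by the simple reflections in `J`. -/
def parabolic (cs : CoxeterSystem A W) (J : Set B) : Subgroup W :=
  Subgroup.closure (cs.simple '' J)

/-- The Cayley graph of `(W, S)`: the vertices are the elements of `W` (the chambers), and `w` is
adjacent to `w * s` for every simple reflection `s`. -/
def cayleyGraph (cs : CoxeterSystem A W) : SimpleGraph W :=
  SimpleGraph.mulCayley (Set.range cs.simple)

/-- The vertices of the Wythoffian polytope with set of active mirrors `M`: the `W`-orbit of the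
base point `x₀`, which lies exactly on those walls of the fundamental chamber that belong to the
inactive mirrors, so that its stabilizer is the standard parabolic subgroup on `Mᶜ`. The vertex
`w x₀` is the coset of `w`; as a set, this coset is the set of all chambers that contain `w x₀`. -/
abbrev Vertex (cs : CoxeterSystem A W) (M : Set B) : Type _ :=
  W ⧸ parabolic cs Mᶜ

/-- The map from chambers to vertices: it sends the chamber `w` to the unique vertex of the
polytope that it contains, namely `w x₀`. -/
def chamberVertex (cs : CoxeterSystem A W) (M : Set B) (w : W) : Vertex cs M :=
  QuotientGroup.mk w

/-- The set of vertices `w W_J x₀`: the image under `w` of the standard face on `W_J`. -/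
def faceSet (cs : CoxeterSystem A W) (M : Set B) (w : W) (J : Set B) : Set (Vertex cs M) :=
  {v | ∃ u ∈ parabolic cs J, v = chamberVertex cs M (w * u)}

/-- The faces of the Wythoffian polytope `P_{W,M}`, given by their vertex sets: the least face
(the empty one) and the images under `W` of the standard faces. The abstract polytope `P_{W,M}` is
this type, ordered by inclusion. -/
def Face (cs : CoxeterSystem A W) (M : Set B) : Type _ :=
  {F : Set (Vertex cs M) // F = ∅ ∨ ∃ (w : W) (J : Set B), F = faceSet cs M w J}

instance (cs : CoxeterSystem A W) (M : Set B) : PartialOrder (Face cs M) :=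
  inferInstanceAs (PartialOrder
    {F : Set (Vertex cs M) // F = ∅ ∨ ∃ (w : W) (J : Set B), F = faceSet cs M w J})

theorem parabolic_univ (cs : CoxeterSystem A W) : parabolic cs Set.univ = ⊤ := by
  rw [parabolic, Set.image_univ, cs.subgroup_closure_range_simple]

theorem faceSet_univ (cs : CoxeterSystem A W) (M : Set B) :
    faceSet cs M 1 Set.univ = Set.univ := by
  ext v
  induction v using QuotientGroup.induction_on with
  | H w => simp only [Set.mem_univ, iff_true]
           exact ⟨w, by rw [parabolic_univ]; trivial, by rw [one_mul]; rfl⟩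

instance (cs : CoxeterSystem A W) (M : Set B) : BoundedOrder (Face cs M) where
  bot := ⟨∅, Or.inl rfl⟩
  bot_le F := Set.empty_subset F.1
  top := ⟨Set.univ, Or.inr ⟨1, Set.univ, (faceSet_univ cs M).symm⟩⟩
  le_top F := Set.subset_univ F.1

theorem faceSet_empty (cs : CoxeterSystem A W) (M : Set B) (w : W) :
    faceSet cs M w ∅ = {chamberVertex cs M w} := by
  ext v
  simp [faceSet, parabolic]

/-- A vertex, seen as a face. -/
def vertexFace (cs : CoxeterSystem A W) (M : Set B) (v : Vertex cs M) : Face cs M :=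
  ⟨{v}, Or.inr (by
    induction v using QuotientGroup.induction_on with
    | H w => exact ⟨w, ∅, (faceSet_empty cs M w).symm⟩)⟩

/-- The link of a face `F`: the section of the polytope between `F` and the greatest face. -/
def link (cs : CoxeterSystem A W) (M : Set B) (F : Face cs M) : Set (Face cs M) :=
  Set.Icc F ⊤

/-- The polytope has finite vertex links. -/
def HasFiniteVertexLinks (cs : CoxeterSystem A W) (M : Set B) : Prop :=
  ∀ v : Vertex cs M, (link cs M (vertexFace cs M v)).Finite

/-- The `1`-skeleton of the polytope: `x₀` is joined to each of its reflections `s x₀ ≠ x₀` in the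
walls of the fundamental chamber, and the edges are the images of these edges under `W`. -/
def skeleton (cs : CoxeterSystem A W) (M : Set B) : SimpleGraph (Vertex cs M) where
  Adj v v' := v ≠ v' ∧ ∃ (w : W) (s : B),
    v = chamberVertex cs M w ∧ v' = chamberVertex cs M (w * cs.simple s)
  symm := ⟨by
    rintro v v' ⟨h, w, s, rfl, rfl⟩
    exact ⟨h.symm, w * cs.simple s, s, rfl, by rw [cs.simple_mul_simple_cancel_right]⟩⟩
  loopless := ⟨fun _ h => h.1 rfl⟩

/-- The Cayley graph is connected, so its geodesic distance is a metric. -/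
theorem cayleyGraph_connected (cs : CoxeterSystem A W) : (cayleyGraph cs).Connected := by
  have key : ∀ w : W, (cayleyGraph cs).Reachable 1 w := by
    intro w
    induction w using cs.simple_induction_right with
    | one => exact SimpleGraph.Reachable.refl _
    | mul_simple_right w s hw =>
      refine hw.trans ?_
      by_cases h : w = w * cs.simple s
      · rw [← h]
      · refine SimpleGraph.Adj.reachable ?_
        rw [cayleyGraph, SimpleGraph.mulCayley_adj']
        exact ⟨h, _, ⟨s, rfl⟩, Or.inl rfl⟩
  exact { preconnected := fun u v => (key u).symm.trans (key v), nonempty := ⟨1⟩ }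

/-- The `1`-skeleton is connected, so its geodesic distance is a metric. -/
theorem skeleton_connected (cs : CoxeterSystem A W) (M : Set B) : (skeleton cs M).Connected := by
  have key : ∀ w : W, (skeleton cs M).Reachable (chamberVertex cs M 1) (chamberVertex cs M w) := by
    intro w
    induction w using cs.simple_induction_right with
    | one => exact SimpleGraph.Reachable.refl _
    | mul_simple_right w s hw =>
      refine hw.trans ?_
      by_cases h : chamberVertex cs M w = chamberVertex cs M (w * cs.simple s)
      · rw [← h]
      · exact SimpleGraph.Adj.reachable ⟨h, w, s, rfl, rfl⟩
  refine { preconnected := fun u v => ?_, nonempty := ⟨chamberVertex cs M 1⟩ }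
  induction u using QuotientGroup.induction_on with
  | H u =>
    induction v using QuotientGroup.induction_on with
    | H v => exact (key u).symm.trans (key v)

end Wythoff

/-!
Write `W_J` for `parabolic cs J` and `x₀` for the base vertex, whose stabilizer is `W_{S ∖ M}`.

If `W_{S ∖ M}` is finite, then only finitely many faces contain `x₀`. A path of length `n` in the
skeleton is a word with `n` letters in `M` and at most `n + 1` blocks of letters outside `M`
(`exists_word_of_skeleton_dist`), which gives the bound on `d_S`
(`cayleyGraph_dist_le_skeleton_dist`) and the quasi-isometries in both directions. What remains is
that finite links, or a quasi-isometry from the skeleton to the Cayley graph, force `W_{S ∖ M}` to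
be finite. Suppose that it is infinite. By the assumption on `M` there are a connected `C ⊆ S ∖ M`
with `W_C` infinite and some `m ∈ M` adjacent to `C` (`exists_connected_adjacent`).

The Coxeter theory rests on the cocycle `w ↦ N(w)` of inversions (`mem_inversions_mul`), obtained
from an action of `W` on `W × ℤ/2`; the geometric representation is used only to see that distinct
indices give distinct generators and that these commute only if `m s t = 2`. A direct argument with
`N` shows that an element of `W_J ∩ s W_J s`, with `s ∉ J`, commutes with `s` and lies in the
parabolic subgroup on those generators in `J` that commute with `s`
(`commute_of_conj_mem_parabolic`, `mem_parabolic_of_commute`). Hence a subgroup of finite index of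
`W_C` cannot commute with `m`: its normal core would be trivial
(`finite_parabolic_of_finite_range`). As the edges `{x₀, u m x₀}`, for `u ∈ W_C`, are permuted by
`W_C`, there are infinitely many of them, so the link of `x₀` is infinite
(`finite_of_hasFiniteVertexLinks`).

For the coarse statement, the main fact is that an infinite irreducible `W_C` is not a bounded
product of proper standard parabolic subgroups (`not_parabolic_subset_pow`). A residue `g W_K` of
corank one in `W_{C ∪ {m}}` projects to a proper residue of `W_C`, unless `W_C` stabilizes it
(`proj_residue`), and the only one stabilized is `W_C` itself, by a case of Deodhar's theorem
(`mem_parabolic_of_conj_mem`). So if `u ∈ W_C` is not a short product of elements of proper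
parabolic subgroups, every short path of residues from `w` to `u w` passes through `W_C`, and thus
is at least about twice as long as a shortest one from `w` to `W_C` (`mem_pow_of_conj_mem_pow`). This
doubling proves `not_parabolic_subset_pow` by induction on `C`, and it also shows that the points
`u w x₀`, for `u ∈ W_C` and a fixed `w` far out in `W_{C ∪ {m}}`, which all have the same distance from
`x₀`, are not covered by finitely many sets of a given diameter. A quasi-isometry to the locally
finite Cayley graph would provide such a cover (`finite_of_quasiIsometric`).
-/

namespace Wythoff

variable {B W : Type*} [Group W] {A : CoxeterMatrix B}

/-! ### The geometric representation -/

/-- The linear form `v ↦ 2 B(e_s, v)` on the space spanned by the simple roots, where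
`B(e_s, e_t) = - cos (π / m s t)`. For `m s t = ∞`, encoded as `0`, the junk value `π / 0 = 0` gives
the customary `B(e_s, e_t) = -1`. -/
noncomputable def rootForm (A : CoxeterMatrix B) (s : B) : Module.Dual ℝ (B →₀ ℝ) :=
  Finsupp.linearCombination ℝ fun t => -2 * Real.cos (Real.pi / A s t)

theorem rootForm_single (A : CoxeterMatrix B) (s t : B) :
    rootForm A s (Finsupp.single t 1) = -2 * Real.cos (Real.pi / A s t) := by
  simp [rootForm]

theorem rootForm_single_self (A : CoxeterMatrix B) (s : B) :
    rootForm A s (Finsupp.single s 1) = 2 := by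
  simp [rootForm_single]

/-- The reflection in the simple root `e_s`. -/
noncomputable def rootReflection (A : CoxeterMatrix B) (s : B) :
    (B →₀ ℝ) ≃ₗ[ℝ] (B →₀ ℝ) :=
  Module.reflection (rootForm_single_self A s)

theorem rootReflection_apply (A : CoxeterMatrix B) (s : B) (v : B →₀ ℝ) :
    rootReflection A s v = v - rootForm A s v • Finsupp.single s 1 :=
  Module.reflection_apply (f := rootForm A s) (y := v) (rootForm_single_self A s)

open Polynomial.Chebyshev in
theorem isLiftable_rootReflection (A : CoxeterMatrix B) :
    A.IsLiftable (rootReflection A) := by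
  intro s t
  by_cases hst : s = t
  · subst hst
    rw [A.diagonal, pow_one]
    ext1 v
    exact Module.involutive_reflection (rootForm_single_self A s) v
  have h1 : A s t ≠ 1 := A.off_diagonal s t hst
  rcases Nat.eq_zero_or_pos (A s t) with h0 | hpos
  · rw [h0, pow_zero]
  set m := A s t with hm
  obtain hm_eq | hm3 : m = 2 ∨ 3 ≤ m := by omega
  · have h1 : rootForm A s (Finsupp.single t 1) = 0 := by
      rw [rootForm_single, ← hm, hm_eq]; simp
    have h2 : rootForm A t (Finsupp.single s 1) = 0 := by
      rw [rootForm_single, A.symmetric t s, ← hm, hm_eq]; simp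
    rw [hm_eq, pow_two]
    refine LinearEquiv.ext fun v => ?_
    simp only [LinearEquiv.mul_apply, rootReflection_apply, map_sub, map_smul, h1, h2,
      rootForm_single_self]
    change _ = v
    module
  set φ : ℝ := 2 * Real.pi / m with hφ
  have hm0 : (m : ℝ) ≠ 0 := by positivity
  have hmφ : m * φ = 2 * Real.pi := by rw [hφ]; field_simp
  have ht : rootForm A s (Finsupp.single t 1) * rootForm A t (Finsupp.single s 1) - 2 =
      2 * Real.cos φ := by
    rw [rootForm_single, rootForm_single, A.symmetric t s, ← hm, hφ, mul_div_assoc,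
      Real.cos_two_mul]
    ring
  have key := Module.reflection_mul_reflection_pow (rootForm_single_self A s)
    (rootForm_single_self A t) m (2 * Real.cos φ) ht.symm
  apply LinearEquiv.toLinearMap_injective
  refine key.trans ?_
  -- It remains to see that both coefficients vanish; they are values of Chebyshev polynomials.
  suffices h : ((S ℝ ((m - 2) / 2)).eval (2 * Real.cos φ) *
        ((S ℝ ((m - 1) / 2)).eval (2 * Real.cos φ) +
          (S ℝ ((m - 3) / 2)).eval (2 * Real.cos φ))) = 0 ∧
      ((S ℝ ((m - 1) / 2)).eval (2 * Real.cos φ) *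
        ((S ℝ (m / 2)).eval (2 * Real.cos φ) + (S ℝ ((m - 2) / 2)).eval (2 * Real.cos φ))) = 0 by
    rw [h.1, h.2, zero_smul, zero_smul, add_zero, add_zero]
    rfl
  have hsin : Real.sin φ ≠ 0 := by
    have h3 : (3 : ℝ) ≤ m := by exact_mod_cast hm3
    refine (Real.sin_pos_of_pos_of_lt_pi (by positivity) ?_).ne'
    rw [hφ, div_lt_iff₀ (by linarith)]
    nlinarith [Real.pi_pos]
  obtain ⟨k, hk | hk⟩ := Nat.even_or_odd' m
  · have e1 : ((m : ℤ) - 2) / 2 = k - 1 := by omega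
    have e2 : ((m : ℤ) - 1) / 2 = k - 1 := by omega
    have hz : (S ℝ ((k : ℤ) - 1)).eval (2 * Real.cos φ) = 0 := by
      have h := S_two_mul_real_cos φ ((k : ℤ) - 1)
      have hkφ : ((((k : ℤ) - 1 : ℤ) : ℝ) + 1) * φ = Real.pi := by
        rw [hk] at hmφ; push_cast at hmφ ⊢; linarith
      rw [hkφ, Real.sin_pi] at h
      exact (mul_eq_zero.mp h).resolve_right hsin
    rw [e1, e2, hz]
    simp
  · have e1 : ((m : ℤ) - 2) / 2 = k - 1 := by omega
    have e2 : ((m : ℤ) - 1) / 2 = k := by omega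
    have e3 : ((m : ℤ) - 3) / 2 = k - 1 := by omega
    have e4 : (m : ℤ) / 2 = k := by omega
    have hz : (S ℝ (k : ℤ)).eval (2 * Real.cos φ) +
        (S ℝ ((k : ℤ) - 1)).eval (2 * Real.cos φ) = 0 := by
      have h := S_two_mul_real_cos φ ((k : ℤ) - 1)
      have h' := S_two_mul_real_cos φ (k : ℤ)
      have hkφ : ((((k : ℤ) : ℤ) : ℝ) + 1) * φ =
          2 * Real.pi - ((((k : ℤ) - 1 : ℤ) : ℝ) + 1) * φ := by
        rw [hk] at hmφ; push_cast at hmφ ⊢; linarith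
      rw [hkφ, Real.sin_two_pi_sub] at h'
      refine (mul_eq_zero.mp ?_).resolve_right hsin
      rw [add_mul, h, h', neg_add_cancel]
    rw [e1, e2, e3, e4, hz]
    simp

/-- The geometric representation of a Coxeter group. -/
noncomputable def geometricRep (cs : CoxeterSystem A W) : W →* (B →₀ ℝ) ≃ₗ[ℝ] (B →₀ ℝ) :=
  cs.lift ⟨rootReflection A, isLiftable_rootReflection A⟩

theorem geometricRep_simple (cs : CoxeterSystem A W) (s : B) :
    geometricRep cs (cs.simple s) = rootReflection A s :=
  cs.lift_apply_simple _ _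

theorem eq_or_eq_two_of_commute (cs : CoxeterSystem A W) {s t : B}
    (h : cs.simple s * cs.simple t = cs.simple t * cs.simple s) : s = t ∨ A s t = 2 := by
  by_contra! hcon
  obtain ⟨hst, h2⟩ := hcon
  have h' := congrArg (fun w => geometricRep cs w (Finsupp.single t 1) s) h
  simp only [map_mul, geometricRep_simple, LinearEquiv.mul_apply, rootReflection_apply,
    map_sub, map_smul, rootForm_single] at h'
  simp only [A.symmetric t s] at h'
  simp [hst] at h'
  have hcos : Real.cos (Real.pi / A s t) = 0 := by linarith
  rcases Nat.eq_zero_or_pos (A s t) with h0 | hpos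
  · simp [h0] at hcos
  have h1 : A s t ≠ 1 := A.off_diagonal s t hst
  have h3 : (3 : ℝ) ≤ A s t := by exact_mod_cast (by omega : 3 ≤ A s t)
  refine (Real.cos_pos_of_mem_Ioo ⟨?_, ?_⟩).ne' hcos
  · have : 0 < Real.pi / A s t := by positivity
    linarith [Real.pi_pos]
  · rw [div_lt_iff₀ (by linarith)]
    nlinarith [Real.pi_pos]

theorem simple_mul_comm_of_eq_two (cs : CoxeterSystem A W) {s t : B} (h : A s t = 2) :
    cs.simple s * cs.simple t = cs.simple t * cs.simple s := by
  have h1 := cs.simple_mul_simple_pow s t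
  rw [h, pow_two] at h1
  have h2 := eq_inv_of_mul_eq_one_left h1
  rwa [mul_inv_rev, cs.inv_simple, cs.inv_simple] at h2

theorem simple_injective (cs : CoxeterSystem A W) : Function.Injective cs.simple := by
  intro s t h
  by_contra hst
  have h' := congrArg (fun w => geometricRep cs w (Finsupp.single s 1) s) h
  simp [geometricRep_simple, rootReflection_apply, rootForm_single, hst] at h'

/-! ### The inversion cocycle -/

open Classical in
/-- The permutation `(r, ε) ↦ (s r s, ε + [r = s])` of `W × ℤ/2`. The first factor is all of `W`
instead of the set of reflections; elements that are not reflections do no harm. -/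
noncomputable def signedConj (cs : CoxeterSystem A W) (s : B) : Equiv.Perm (W × ZMod 2) :=
  Function.Involutive.toPerm
    (fun x => (cs.simple s * x.1 * cs.simple s, x.2 + if x.1 = cs.simple s then 1 else 0)) <| by
    rintro ⟨r, ε⟩
    have h : cs.simple s * r * cs.simple s = cs.simple s ↔ r = cs.simple s := by
      constructor
      · intro h
        have h' := congrArg (fun x => cs.simple s * x * cs.simple s) h
        simpa [mul_assoc] using h'
      · rintro rfl
        simp
    simp only [h, add_assoc, CharTwo.add_self_eq_zero, add_zero]
    simp [mul_assoc]

open Classical in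
theorem signedConj_apply (cs : CoxeterSystem A W) (s : B) (x : W × ZMod 2) :
    signedConj cs s x =
      (cs.simple s * x.1 * cs.simple s, x.2 + if x.1 = cs.simple s then 1 else 0) := rfl

open Classical in
theorem signedConj_mul_pow_apply (cs : CoxeterSystem A W) (s t : B) (k : ℕ) (r : W) (ε : ZMod 2) :
    ((signedConj cs s * signedConj cs t) ^ k) (r, ε) =
      ((cs.simple s * cs.simple t) ^ k * r * ((cs.simple s * cs.simple t) ^ k)⁻¹,
        ε + ∑ i ∈ Finset.range (2 * k),
          if r = cs.simple t * (cs.simple s * cs.simple t) ^ i then 1 else 0) := by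
  induction k with
  | zero => simp
  | succ k ih =>
    set q := cs.simple s * cs.simple t with hq
    have htq : ∀ i : ℕ, cs.simple t * q ^ i = (q ^ i)⁻¹ * cs.simple t := by
      intro i
      induction i with
      | zero => simp
      | succ i ih =>
        rw [pow_succ, ← mul_assoc, ih, ← pow_succ, pow_succ', mul_inv_rev, mul_assoc, mul_assoc]
        simp [hq, mul_assoc]
    have e1 : q ^ k * r * (q ^ k)⁻¹ = cs.simple t ↔ r = cs.simple t * q ^ (2 * k) := by
      rw [two_mul, pow_add, ← mul_assoc, htq, mul_inv_eq_iff_eq_mul, mul_assoc,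
        ← eq_inv_mul_iff_mul_eq]
    have e2 : cs.simple t * (q ^ k * r * (q ^ k)⁻¹) * cs.simple t = cs.simple s ↔
        r = cs.simple t * q ^ (2 * k + 1) := by
      have : cs.simple t * q ^ (2 * k + 1) = (q ^ k)⁻¹ * (cs.simple t * q) * q ^ k := by
        rw [two_mul, add_assoc, pow_add, ← mul_assoc, htq, pow_succ']
        simp only [mul_assoc]
      rw [this]
      constructor
      · intro h
        have : cs.simple t * q = q ^ k * r * (q ^ k)⁻¹ := by
          have h' := congrArg (fun x => cs.simple t * x * cs.simple t) h
          simp only [← mul_assoc, cs.simple_mul_simple_self, one_mul] at h'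
          simpa [hq, mul_assoc] using h'.symm
        rw [this]; group
      · rintro rfl
        simp [hq, mul_assoc]
    rw [pow_succ', Equiv.Perm.mul_apply, ih, Equiv.Perm.mul_apply, signedConj_apply,
      signedConj_apply, mul_add, mul_one, Finset.sum_range_succ, Finset.sum_range_succ]
    simp only [e1, e2]
    refine Prod.ext ?_ (by simp only [add_assoc])
    simp only [pow_succ', mul_inv_rev, hq, cs.inv_simple, mul_assoc]

theorem isLiftable_signedConj (cs : CoxeterSystem A W) : A.IsLiftable (signedConj cs) := by
  classical
  intro s t
  ext1 ⟨r, ε⟩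
  have hq := cs.simple_mul_simple_pow s t
  rw [signedConj_mul_pow_apply, hq, two_mul, Finset.sum_range_add]
  -- The reflections met along the relator `(s t) ^ m` repeat with period `m`.
  simp only [pow_add, hq, one_mul, CharTwo.add_self_eq_zero]
  simp

/-- The set `N(w)` of (left) inversions of `w`: the reflections whose walls separate the chambers
`1` and `w`. It is defined by the parity with which a word for `w` crosses the wall, which makes
the cocycle rule `mem_inversions_mul` immediate. -/
def inversions (cs : CoxeterSystem A W) (w : W) : Set W :=
  {r | (cs.lift ⟨signedConj cs, isLiftable_signedConj cs⟩ w⁻¹ (r, 0)).2 = 1}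

theorem lift_signedConj_apply (cs : CoxeterSystem A W) (w r : W) (ε : ZMod 2) :
    cs.lift ⟨signedConj cs, isLiftable_signedConj cs⟩ w (r, ε) =
      (w * r * w⁻¹,
        ε + (cs.lift ⟨signedConj cs, isLiftable_signedConj cs⟩ w (r, 0)).2) := by
  induction w using cs.simple_induction_left generalizing r ε with
  | one => simp
  | mul_simple_left w s ih =>
    simp only [map_mul, cs.lift_apply_simple, Equiv.Perm.mul_apply]
    rw [ih r ε, ih r 0]
    simp [signedConj_apply, mul_assoc, add_assoc]

theorem mem_inversions_mul (cs : CoxeterSystem A W) (u v r : W) :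
    r ∈ inversions cs (u * v) ↔ Xor (r ∈ inversions cs u) (u⁻¹ * r * u ∈ inversions cs v) := by
  have hZ : ∀ a b : ZMod 2, a + b = 1 ↔ Xor (a = 1) (b = 1) := by
    unfold Xor; decide
  simp only [inversions, Set.mem_ofPred_eq]
  rw [mul_inv_rev, map_mul, Equiv.Perm.mul_apply, lift_signedConj_apply cs u⁻¹,
    lift_signedConj_apply cs v⁻¹, zero_add, hZ, inv_inv]

theorem inversions_one (cs : CoxeterSystem A W) : inversions cs 1 = ∅ := by
  ext r
  simp [inversions]

theorem inversions_simple (cs : CoxeterSystem A W) (s : B) :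
    inversions cs (cs.simple s) = {cs.simple s} := by
  ext r
  simp only [inversions, Set.mem_ofPred_eq, cs.inv_simple, cs.lift_apply_simple, signedConj_apply]
  simp

theorem mem_inversions_mul_simple (cs : CoxeterSystem A W) (w r : W) (s : B) :
    r ∈ inversions cs (w * cs.simple s) ↔
      Xor (r ∈ inversions cs w) (r = w * cs.simple s * w⁻¹) := by
  rw [mem_inversions_mul, inversions_simple, Set.mem_singleton_iff]
  have : w⁻¹ * r * w = cs.simple s ↔ r = w * cs.simple s * w⁻¹ := by
    rw [mul_assoc, inv_mul_eq_iff_eq_mul, eq_mul_inv_iff_mul_eq]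
  rw [this]

theorem mem_inversions_simple_mul (cs : CoxeterSystem A W) (w r : W) (s : B) :
    r ∈ inversions cs (cs.simple s * w) ↔
      Xor (r = cs.simple s) (cs.simple s * r * cs.simple s ∈ inversions cs w) := by
  rw [mem_inversions_mul, inversions_simple, Set.mem_singleton_iff, cs.inv_simple]

theorem simple_mem_inversions_simple_mul (cs : CoxeterSystem A W) (w : W) (s : B) :
    cs.simple s ∈ inversions cs (cs.simple s * w) ↔ cs.simple s ∉ inversions cs w := by
  rw [mem_inversions_simple_mul, cs.simple_mul_simple_self, one_mul]
  simp [Xor]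

theorem finite_inversions (cs : CoxeterSystem A W) (w : W) : (inversions cs w).Finite := by
  induction w using cs.simple_induction_right with
  | one => simp [inversions_one]
  | mul_simple_right w s ih =>
    refine (ih.union (Set.finite_singleton (w * cs.simple s * w⁻¹))).subset fun r hr => ?_
    rw [mem_inversions_mul_simple] at hr
    rcases hr with h | h
    · exact Or.inl h.1
    · exact Or.inr h.1

/-- The exchange condition. -/
theorem exists_sublist_of_mem_inversions (cs : CoxeterSystem A W) (ω : List B) {r : W}
    (hr : r ∈ inversions cs (cs.wordProd ω)) :
    ∃ ω' : List B, ω'.Sublist ω ∧ ω'.length < ω.length ∧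
      r * cs.wordProd ω = cs.wordProd ω' := by
  induction ω generalizing r with
  | nil => simp [inversions_one] at hr
  | cons s ω ih =>
    rw [cs.wordProd_cons, mem_inversions_simple_mul] at hr
    rcases hr with ⟨rfl, -⟩ | ⟨h, -⟩
    · exact ⟨ω, List.sublist_cons_self s ω, by simp, by simp [cs.wordProd_cons]⟩
    · obtain ⟨ω', h1, h2, h3⟩ := ih h
      refine ⟨s :: ω', h1.cons_cons s, by simpa using h2, ?_⟩
      rw [cs.wordProd_cons, cs.wordProd_cons, ← h3]
      simp [mul_assoc]

/-! ### Standard parabolic subgroups -/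

theorem simple_mem_parabolic (cs : CoxeterSystem A W) {J : Set B} {s : B} (hs : s ∈ J) :
    cs.simple s ∈ parabolic cs J :=
  Subgroup.subset_closure ⟨s, hs, rfl⟩

theorem parabolic_mono (cs : CoxeterSystem A W) {J K : Set B} (h : J ⊆ K) :
    parabolic cs J ≤ parabolic cs K :=
  Subgroup.closure_mono (Set.image_mono h)

theorem parabolic_induction_right (cs : CoxeterSystem A W) {J : Set B} {p : W → Prop} {w : W}
    (hw : w ∈ parabolic cs J) (one : p 1)
    (mul_simple : ∀ w ∈ parabolic cs J, ∀ s ∈ J, p w → p (w * cs.simple s)) : p w := by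
  have h : w ∈ parabolic cs J ∧ p w := by
    rw [parabolic] at hw
    induction hw using Subgroup.closure_induction_right with
    | one => exact ⟨one_mem _, one⟩
    | mul_right x _ y hy ih =>
      obtain ⟨s, hs, rfl⟩ := hy
      exact ⟨mul_mem ih.1 (simple_mem_parabolic cs hs), mul_simple x ih.1 s hs ih.2⟩
    | mul_inv_cancel x _ y hy ih =>
      obtain ⟨s, hs, rfl⟩ := hy
      rw [cs.inv_simple]
      exact ⟨mul_mem ih.1 (simple_mem_parabolic cs hs), mul_simple x ih.1 s hs ih.2⟩
  exact h.2

theorem wordProd_mem_parabolic (cs : CoxeterSystem A W) {J : Set B} {ω : List B}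
    (hω : ∀ s ∈ ω, s ∈ J) : cs.wordProd ω ∈ parabolic cs J := by
  induction ω with
  | nil => simp
  | cons s ω ih =>
    rw [cs.wordProd_cons]
    exact mul_mem (simple_mem_parabolic cs (hω s (by simp))) (ih fun t ht => hω t (by simp [ht]))

theorem exists_word_of_mem_parabolic (cs : CoxeterSystem A W) {J : Set B} {w : W}
    (hw : w ∈ parabolic cs J) : ∃ ω : List B, (∀ s ∈ ω, s ∈ J) ∧ w = cs.wordProd ω := by
  refine parabolic_induction_right cs hw
    (p := fun w => ∃ ω : List B, (∀ s ∈ ω, s ∈ J) ∧ w = cs.wordProd ω)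
    ⟨[], by simp, by simp⟩ fun w _ s hs ih => ?_
  obtain ⟨ω, h1, rfl⟩ := ih
  refine ⟨ω ++ [s], ?_, by simp [cs.wordProd_append]⟩
  intro t ht
  rcases List.mem_append.mp ht with h | h
  · exact h1 t h
  · rw [List.mem_singleton.mp h]; exact hs

theorem inversions_subset_parabolic (cs : CoxeterSystem A W) {J : Set B} {w : W}
    (hw : w ∈ parabolic cs J) : inversions cs w ⊆ parabolic cs J := by
  refine parabolic_induction_right cs hw (p := fun w => inversions cs w ⊆ parabolic cs J)
    (by simp [inversions_one]) fun w hw s hs ih => ?_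
  intro r hr
  rw [mem_inversions_mul_simple] at hr
  rcases hr with h | h
  · exact ih h.1
  · rw [h.1]
    exact mul_mem (mul_mem hw (simple_mem_parabolic cs hs)) (inv_mem hw)

theorem exists_simple_mem_inversions (cs : CoxeterSystem A W) {J : Set B} {w : W}
    (hw : w ∈ parabolic cs J) (h1 : w ≠ 1) : ∃ s ∈ J, cs.simple s ∈ inversions cs w := by
  classical
  have hex : ∃ n, ∃ ω : List B, ω.length = n ∧ (∀ s ∈ ω, s ∈ J) ∧ w = cs.wordProd ω := by
    obtain ⟨ω, h⟩ := exists_word_of_mem_parabolic cs hw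
    exact ⟨_, ω, rfl, h⟩
  obtain ⟨ω, hlen, hJ, rfl⟩ := Nat.find_spec hex
  have hmin : ∀ ω' : List B, (∀ s ∈ ω', s ∈ J) → cs.wordProd ω = cs.wordProd ω' →
      ω.length ≤ ω'.length := fun ω' h h' => hlen ▸ Nat.find_min' hex ⟨ω', rfl, h, h'⟩
  match ω, hJ, hmin, h1 with
  | [], _, _, h1 => simp at h1
  | s :: ω, hJ, hmin, _ =>
    refine ⟨s, hJ s (by simp), ?_⟩
    by_contra hs
    rw [cs.wordProd_cons, simple_mem_inversions_simple_mul, not_not] at hs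
    -- The exchange condition would give a shorter word.
    obtain ⟨ω', h2, h3, h4⟩ := exists_sublist_of_mem_inversions cs ω hs
    have := hmin ω' (fun t ht => hJ t (by simp [h2.subset ht])) (by rw [cs.wordProd_cons, h4])
    simp at this
    omega

theorem simple_ne_one (cs : CoxeterSystem A W) (s : B) : cs.simple s ≠ 1 := by
  intro h
  have := inversions_simple cs s
  rw [h, inversions_one] at this
  exact (Set.singleton_ne_empty _ this.symm).elim

theorem simple_mem_parabolic_iff (cs : CoxeterSystem A W) {J : Set B} {s : B} :
    cs.simple s ∈ parabolic cs J ↔ s ∈ J := by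
  refine ⟨fun h => ?_, simple_mem_parabolic cs⟩
  obtain ⟨t, ht, h'⟩ := exists_simple_mem_inversions cs h (simple_ne_one cs s)
  rw [inversions_simple, Set.mem_singleton_iff] at h'
  rwa [← simple_injective cs h']

/-- Deletion: a word representing an element of `W_J` contains a word in `J` for that element. -/
theorem exists_sublist_of_mem_parabolic (cs : CoxeterSystem A W) {J : Set B} :
    ∀ (n : ℕ) (ω : List B), ω.length = n → cs.wordProd ω ∈ parabolic cs J →
      ∃ ω' : List B, ω'.Sublist ω ∧ (∀ s ∈ ω', s ∈ J) ∧ cs.wordProd ω' = cs.wordProd ω := by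
  intro n
  induction n using Nat.strong_induction_on with
  | _ n ih =>
    rintro (_ | ⟨s, ω⟩) hn hω
    · exact ⟨[], List.Sublist.refl _, by simp, rfl⟩
    by_cases hs : cs.simple s ∈ inversions cs (cs.wordProd (s :: ω))
    · have hsJ := inversions_subset_parabolic cs hω hs
      have hω' : cs.wordProd ω ∈ parabolic cs J := by
        have := mul_mem hsJ hω
        rwa [cs.wordProd_cons, cs.simple_mul_simple_cancel_left] at this
      obtain ⟨ω', h1, h2, h3⟩ := ih ω.length (by simp at hn; omega) ω rfl hω'
      refine ⟨s :: ω', h1.cons_cons s, ?_, by rw [cs.wordProd_cons, h3, cs.wordProd_cons]⟩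
      intro t ht
      rcases List.mem_cons.mp ht with rfl | ht
      · exact (simple_mem_parabolic_iff cs).mp hsJ
      · exact h2 t ht
    · rw [cs.wordProd_cons, simple_mem_inversions_simple_mul, not_not] at hs
      obtain ⟨ω', h1, h2, h3⟩ := exists_sublist_of_mem_inversions cs ω hs
      rw [cs.wordProd_cons, h3] at hω
      obtain ⟨ω'', h4, h5, h6⟩ := ih ω'.length (by simp at hn; omega) ω' rfl hω
      exact ⟨ω'', h4.trans (h1.trans (List.sublist_cons_self s ω)), h5,
        by rw [h6, cs.wordProd_cons, h3]⟩

/-- If `s ∉ J`, an element of `W_J ∩ s W_J s` commutes with `s`. -/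
theorem commute_of_conj_mem_parabolic (cs : CoxeterSystem A W) {J : Set B} {s : B} (hs : s ∉ J)
    {w : W} (hw : w ∈ parabolic cs J) (hsw : cs.simple s * w * cs.simple s ∈ parabolic cs J) :
    cs.simple s * w = w * cs.simple s := by
  have hs' : ∀ {v}, v ∈ parabolic cs J → cs.simple s ∉ inversions cs v := fun hv h =>
    hs ((simple_mem_parabolic_iff cs).mp (inversions_subset_parabolic cs hv h))
  set v := cs.simple s * w * cs.simple s with hv
  have e : cs.simple s * w = v * cs.simple s := by rw [hv, cs.simple_mul_simple_cancel_right]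
  -- The wall of `s` is an inversion of `s w`, hence of `v s`; this pins down `v s v⁻¹`.
  have h1 : cs.simple s ∈ inversions cs (cs.simple s * w) := by
    rw [mem_inversions_simple_mul]
    exact Or.inl ⟨rfl, by simpa using hs' hw⟩
  rw [e, mem_inversions_mul_simple] at h1
  rcases h1 with h | h
  · exact (hs' hsw h.1).elim
  · have h2 : cs.simple s * v = v * cs.simple s := by
      rw [← eq_mul_inv_iff_mul_eq]; exact h.1
    have h3 : w = v := by
      rw [← mul_right_inj (cs.simple s), e, h2]
    rw [e, ← h3]

theorem mem_parabolic_of_commute (cs : CoxeterSystem A W) {J : Set B} {s : B} (hs : s ∉ J)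
    {w : W} (hw : w ∈ parabolic cs J) (hsw : cs.simple s * w = w * cs.simple s) :
    w ∈ parabolic cs {t ∈ J | A s t = 2} := by
  induction hn : cs.length w using Nat.strong_induction_on generalizing w with
  | _ n ih =>
    by_cases h1 : w = 1
    · rw [h1]; exact one_mem _
    obtain ⟨t, ht, htw⟩ := exists_simple_mem_inversions cs hw h1
    have hst : s ≠ t := fun h => hs (h ▸ ht)
    -- `N(w)` is stable under conjugation by `s`.
    have h2 : cs.simple s * cs.simple t * cs.simple s ∈ inversions cs w := by
      have h3 : cs.simple t ∈ inversions cs (w * cs.simple s) := by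
        rw [mem_inversions_mul_simple]
        refine Or.inl ⟨htw, ?_⟩
        rw [← hsw, mul_inv_cancel_right]
        exact fun h => hst (simple_injective cs h).symm
      rw [← hsw, mem_inversions_simple_mul] at h3
      rcases h3 with h | h
      · exact (hst (simple_injective cs h.1).symm).elim
      · exact h.1
    have hcomm := commute_of_conj_mem_parabolic cs hs (simple_mem_parabolic cs ht)
      (inversions_subset_parabolic cs hw h2)
    have hA : A s t = 2 := (eq_or_eq_two_of_commute cs hcomm).resolve_left hst
    have hlt : cs.length (cs.simple t * w) < cs.length w := by
      obtain ⟨ω, hω, rfl⟩ := cs.exists_isReduced w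
      obtain ⟨ω', -, h4, h5⟩ := exists_sublist_of_mem_inversions cs ω htw
      rw [h5, hω.eq]
      exact (cs.length_wordProd_le ω').trans_lt h4
    have := ih _ (hn ▸ hlt) (mul_mem (simple_mem_parabolic cs ht) hw)
      (by rw [← mul_assoc, hcomm, mul_assoc, hsw, mul_assoc]) rfl
    have h6 := mul_mem (simple_mem_parabolic cs (J := {t ∈ J | A s t = 2}) ⟨ht, hA⟩) this
    rwa [cs.simple_mul_simple_cancel_left] at h6

/-! ### Connected sets of generators -/

/-- `C` spans a connected subdiagram of the Coxeter diagram: it does not split into two nonempty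
parts that commute with each other. -/
def IsConnectedSet (A : CoxeterMatrix B) (C : Set B) : Prop :=
  ∀ D ⊆ C, D.Nonempty → D ≠ C → ∃ a ∈ D, ∃ b ∈ C \ D, A a b ≠ 2

theorem IsConnectedSet.insert {C : Set B} (hC : IsConnectedSet A C) {a m : B} (ha : a ∈ C)
    (hm : m ∉ C) (ham : A a m ≠ 2) : IsConnectedSet A (insert m C) := by
  intro D hD hne hDC
  by_cases h1 : (D ∩ C).Nonempty
  · by_cases h2 : D ∩ C = C
    · have hCD : C ⊆ D := Set.inter_eq_right.mp h2
      refine ⟨a, hCD ha, m, ⟨Set.mem_insert m C, fun hmD => hDC ?_⟩, ham⟩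
      exact hD.antisymm (Set.insert_subset hmD hCD)
    · obtain ⟨x, hx, y, hy, hxy⟩ := hC _ Set.inter_subset_right h1 h2
      exact ⟨x, hx.1, y, ⟨Set.mem_insert_of_mem m hy.1, fun h => hy.2 ⟨h, hy.1⟩⟩, hxy⟩
  · rw [Set.not_nonempty_iff_eq_empty] at h1
    have haD : a ∉ D := fun h => by
      have : a ∈ D ∩ C := ⟨h, ha⟩
      simp [h1] at this
    have hmD : m ∈ D := by
      obtain ⟨x, hx⟩ := hne
      rcases hD hx with rfl | hxC
      · exact hx
      · have : x ∈ D ∩ C := ⟨hx, hxC⟩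
        simp [h1] at this
    exact ⟨m, hmD, a, ⟨Set.mem_insert_of_mem m ha, haD⟩, by rwa [A.symmetric]⟩

theorem parabolic_empty (cs : CoxeterSystem A W) : parabolic cs ∅ = ⊥ := by
  simp [parabolic]

theorem nonempty_of_infinite_parabolic (cs : CoxeterSystem A W) {C : Set B}
    (hinf : Infinite (parabolic cs C)) : C.Nonempty := by
  by_contra h
  rw [Set.not_nonempty_iff_eq_empty] at h
  rw [h, parabolic_empty] at hinf
  exact not_finite_iff_infinite.mpr hinf inferInstance

/-- An infinite parabolic subgroup contains an infinite irreducible one. -/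
theorem exists_isConnectedSet_infinite [Finite B] (cs : CoxeterSystem A W) {D : Set B}
    (hD : Infinite (parabolic cs D)) :
    ∃ K ⊆ D, IsConnectedSet A K ∧ Infinite (parabolic cs K) := by
  obtain ⟨K, hKD, hK⟩ := exists_minimal_le_of_wellFoundedLT
    (fun K : Set B => Infinite (parabolic cs K)) D hD
  refine ⟨K, hKD, fun E hEK hne hE => ?_, hK.prop⟩
  by_contra! hcon
  have hlt : ∀ F ⊆ K, F ≠ K → Finite (parabolic cs F) := fun F hF hF' => by
    by_contra h
    exact hF' (hK.eq_of_le (not_finite_iff_infinite.mp h) hF)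
  have h1 := hlt E hEK hE
  have h2 := hlt (K \ E) Set.sdiff_subset fun h => by
    obtain ⟨x, hx⟩ := hne
    have : x ∈ K \ E := h.symm ▸ hEK hx
    exact this.2 hx
  -- `W_K` is the product of the commuting finite subgroups on `E` and on `K \ E`.
  have hsub : (parabolic cs K : Set W) ⊆
      Set.image2 (· * ·) (parabolic cs E : Set W) (parabolic cs (K \ E) : Set W) := by
    intro w hw
    refine parabolic_induction_right cs hw
      (p := fun w => w ∈ Set.image2 (· * ·) (parabolic cs E : Set W) (parabolic cs (K \ E) : Set W))
      ⟨1, one_mem _, 1, one_mem _, by simp⟩ ?_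
    rintro _ - s hs ⟨x, hx, y, hy, rfl⟩
    by_cases hsE : s ∈ E
    · have hys : y * cs.simple s = cs.simple s * y := by
        refine parabolic_induction_right cs hy
          (p := fun y => y * cs.simple s = cs.simple s * y) (by simp) fun v _ t ht ih => ?_
        rw [mul_assoc, ← simple_mul_comm_of_eq_two cs (hcon s hsE t ht), ← mul_assoc, ih,
          mul_assoc]
      exact ⟨x * cs.simple s, mul_mem hx (simple_mem_parabolic cs hsE), y, hy, by
        simp only [mul_assoc, hys]⟩
    · exact ⟨x, hx, y * cs.simple s, mul_mem hy (simple_mem_parabolic cs ⟨hs, hsE⟩), by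
        simp only [mul_assoc]⟩
  have hfin := (Set.Finite.image2 (· * ·) (Set.toFinite (parabolic cs E : Set W))
    (Set.toFinite (parabolic cs (K \ E) : Set W))).subset hsub
  exact (not_finite_iff_infinite.mpr hK.prop) hfin.to_subtype

/-- A subgroup of an irreducible `W_C`, normalized by `W_C`, that commutes with a generator outside
`C` adjacent to `C` is trivial. Indeed it lies in `W_K` for some `K ⊆ C`, and a neighbour `t` of `K`
in `C ∪ {m}` cuts down `K` to the elements that commute with `t`. -/
theorem eq_one_of_normalized_of_commute [Finite B] (cs : CoxeterSystem A W) {C : Set B}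
    (hC : IsConnectedSet A C) {a m : B} (ha : a ∈ C) (hm : m ∉ C) (ham : A a m ≠ 2)
    {N : Set W} (hN : N ⊆ parabolic cs C)
    (hconj : ∀ u ∈ parabolic cs C, ∀ n ∈ N, u * n * u⁻¹ ∈ N)
    (hcomm : ∀ n ∈ N, cs.simple m * n = n * cs.simple m) : ∀ n ∈ N, n = 1 := by
  obtain ⟨K, hKC, hK⟩ := exists_minimal_le_of_wellFoundedLT
    (fun K : Set B => K ⊆ C ∧ N ⊆ parabolic cs K) C ⟨subset_rfl, hN⟩
  have hstep : ∀ k ∈ K, ∀ t ∉ K, A k t ≠ 2 →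
      (∀ n ∈ N, cs.simple t * n = n * cs.simple t) → False := by
    intro k hk t ht hkt hcomm'
    have h := hK.eq_of_le (y := {j ∈ K | A t j = 2})
      ⟨fun j hj => hKC hj.1,
        fun n hn => mem_parabolic_of_commute cs ht (hK.prop.2 hn) (hcomm' n hn)⟩ fun j hj => hj.1
    rw [← h] at hk
    exact hkt (by rw [A.symmetric]; exact hk.2)
  by_cases hne : K.Nonempty
  · exfalso
    by_cases hKC' : K = C
    · exact hstep a (hKC' ▸ ha) m (hKC' ▸ hm) ham hcomm
    · obtain ⟨k, hk, t, ht, hkt⟩ := hC K hKC hne hKC'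
      refine hstep k hk t ht.2 hkt fun n hn => ?_
      refine commute_of_conj_mem_parabolic cs ht.2 (hK.prop.2 hn) (hK.prop.2 ?_)
      have := hconj _ (simple_mem_parabolic cs ht.1) n hn
      rwa [cs.inv_simple] at this
  · rw [Set.not_nonempty_iff_eq_empty] at hne
    intro n hn
    have := hK.prop.2 hn
    rw [hne, parabolic_empty] at this
    simpa using this

/-- If `C` is connected and `m ∉ C` is adjacent to `C`, then the centralizer of the generator `m`
has infinite index in `W_C` unless `W_C` is finite. Finite index is expressed by a map with finite
range whose fibres lie in cosets of the centralizer. -/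
theorem finite_parabolic_of_finite_range [Finite B] (cs : CoxeterSystem A W) {C : Set B}
    (hC : IsConnectedSet A C) {a m : B} (ha : a ∈ C) (hm : m ∉ C) (ham : A a m ≠ 2)
    {α : Type*} (f : parabolic cs C → α) (hf : (Set.range f).Finite)
    (hcomm : ∀ u v, f u = f v →
      cs.simple m * (u⁻¹ * v : parabolic cs C) = (u⁻¹ * v : parabolic cs C) * cs.simple m) :
    Finite (parabolic cs C) := by
  set H : Subgroup (parabolic cs C) :=
    (Subgroup.centralizer {cs.simple m}).subgroupOf (parabolic cs C) with hH
  have hmemH : ∀ u : parabolic cs C, u ∈ H ↔ cs.simple m * u = u * cs.simple m := by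
    intro u
    rw [hH, Subgroup.mem_subgroupOf, Subgroup.mem_centralizer_singleton_iff]
    exact eq_comm
  have hfin : Finite (parabolic cs C ⧸ H) := by
    have := hf.to_subtype
    refine Finite.of_injective
      (fun x : parabolic cs C ⧸ H => (⟨f x.out, Set.mem_range_self _⟩ : Set.range f)) ?_
    intro x y hxy
    have h := hcomm _ _ (Subtype.ext_iff.mp hxy)
    rw [← QuotientGroup.out_eq' x, ← QuotientGroup.out_eq' y, QuotientGroup.eq, hmemH]
    exact h
  have : H.FiniteIndex := Subgroup.finiteIndex_of_finite_quotient
  have htriv : ∀ n : parabolic cs C, n ∈ H.normalCore → n = 1 := by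
    intro n hn
    have := eq_one_of_normalized_of_commute cs hC ha hm ham
      (N := {w | ∃ h : w ∈ parabolic cs C, (⟨w, h⟩ : parabolic cs C) ∈ H.normalCore})
      (fun w hw => hw.1)
      (fun u hu n hn => ⟨mul_mem (mul_mem hu hn.1) (inv_mem hu),
        (Subgroup.normalCore_normal H).conj_mem _ hn.2 ⟨u, hu⟩⟩)
      (fun n hn => (hmemH ⟨n, hn.1⟩).mp (Subgroup.normalCore_le H hn.2)) n ⟨n.2, hn⟩
    exact Subtype.ext this
  have hbot : H.normalCore = ⊥ := (Subgroup.eq_bot_iff_forall _).mpr htriv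
  have hfi : H.normalCore.FiniteIndex := inferInstance
  rw [hbot] at hfi
  have : Finite (parabolic cs C ⧸ (⊥ : Subgroup (parabolic cs C))) :=
    Subgroup.finite_quotient_of_finiteIndex
  exact Finite.of_equiv _ (QuotientGroup.quotientBot (G := parabolic cs C)).toEquiv

/-! ### Projection to a parabolic subgroup -/

/-- `w` is the shortest element of `W_J w`: no inversion of `w` lies in `W_J`. -/
def IsLeftMin (cs : CoxeterSystem A W) (J : Set B) (w : W) : Prop :=
  ∀ r ∈ parabolic cs J, r ∉ inversions cs w

theorem IsLeftMin.mul_simple {cs : CoxeterSystem A W} {J : Set B} {w : W}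
    (hw : IsLeftMin cs J w) (s : B) :
    IsLeftMin cs J (w * cs.simple s) ∨ ∃ c ∈ J, w * cs.simple s = cs.simple c * w := by
  by_cases h : w * cs.simple s * w⁻¹ ∈ parabolic cs J
  · right
    have hne : w * cs.simple s * w⁻¹ ≠ 1 := fun h1 => simple_ne_one cs s (by
      simpa using h1)
    obtain ⟨c, hc, hcr⟩ := exists_simple_mem_inversions cs h hne
    have e : w * cs.simple s = w * cs.simple s * w⁻¹ * w := by group
    have h1 : cs.simple c ∈ inversions cs (w * cs.simple s) := by
      rw [e, mem_inversions_mul]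
      exact Or.inl ⟨hcr, hw _ (mul_mem (mul_mem (inv_mem h) (simple_mem_parabolic cs hc)) h)⟩
    rw [mem_inversions_mul_simple] at h1
    rcases h1 with h1 | h1
    · exact (hw _ (simple_mem_parabolic cs hc) h1.1).elim
    · exact ⟨c, hc, by rw [h1.1]; group⟩
  · left
    intro r hr hrw
    rw [mem_inversions_mul_simple] at hrw
    rcases hrw with h1 | h1
    · exact hw r hr h1.1
    · exact h (h1.1 ▸ hr)

theorem exists_isLeftMin (cs : CoxeterSystem A W) (J : Set B) (w : W) :
    ∃ a ∈ parabolic cs J, IsLeftMin cs J (a⁻¹ * w) := by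
  induction w using cs.simple_induction_right with
  | one => exact ⟨1, one_mem _, fun r _ => by simp [inversions_one]⟩
  | mul_simple_right w s ih =>
    obtain ⟨a, ha, hmin⟩ := ih
    rcases hmin.mul_simple s with h | ⟨c, hc, h⟩
    · exact ⟨a, ha, by rwa [← mul_assoc]⟩
    · refine ⟨a * cs.simple c, mul_mem ha (simple_mem_parabolic cs hc), ?_⟩
      rw [mul_inv_rev, mul_assoc, ← mul_assoc, mul_assoc _ a⁻¹, ← mul_assoc a⁻¹, h, cs.inv_simple,
        cs.simple_mul_simple_cancel_left]
      exact hmin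

theorem IsLeftMin.eq_one_of_mul {cs : CoxeterSystem A W} {J : Set B} {u w : W}
    (hu : u ∈ parabolic cs J) (hw : IsLeftMin cs J w) (huw : IsLeftMin cs J (u * w)) : u = 1 := by
  by_contra h
  obtain ⟨c, hc, hcu⟩ := exists_simple_mem_inversions cs hu h
  refine huw _ (simple_mem_parabolic cs hc) ?_
  rw [mem_inversions_mul]
  exact Or.inl ⟨hcu, hw _ (mul_mem (mul_mem (inv_mem hu) (simple_mem_parabolic cs hc)) hu)⟩

/-- The projection of chambers to `W_J`: `w = proj w * w'` with `w'` of minimal length in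
`W_J w`. -/
noncomputable def proj (cs : CoxeterSystem A W) (J : Set B) (w : W) : W :=
  (exists_isLeftMin cs J w).choose

theorem proj_mem (cs : CoxeterSystem A W) (J : Set B) (w : W) : proj cs J w ∈ parabolic cs J :=
  (exists_isLeftMin cs J w).choose_spec.1

theorem isLeftMin_proj_inv_mul (cs : CoxeterSystem A W) (J : Set B) (w : W) :
    IsLeftMin cs J ((proj cs J w)⁻¹ * w) :=
  (exists_isLeftMin cs J w).choose_spec.2

theorem proj_eq_of_isLeftMin (cs : CoxeterSystem A W) {J : Set B} {a w : W}
    (ha : a ∈ parabolic cs J) (h : IsLeftMin cs J (a⁻¹ * w)) : proj cs J w = a := by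
  have h1 := IsLeftMin.eq_one_of_mul (u := a⁻¹ * proj cs J w)
    (mul_mem (inv_mem ha) (proj_mem cs J w)) (isLeftMin_proj_inv_mul cs J w) (by
      rwa [mul_assoc, mul_inv_cancel_left])
  exact (eq_of_inv_mul_eq_one h1).symm

theorem proj_mul (cs : CoxeterSystem A W) {J : Set B} {u : W} (hu : u ∈ parabolic cs J) (w : W) :
    proj cs J (u * w) = u * proj cs J w := by
  refine proj_eq_of_isLeftMin cs (mul_mem hu (proj_mem cs J w)) ?_
  have h := isLeftMin_proj_inv_mul cs J w
  rwa [mul_inv_rev, mul_assoc, inv_mul_cancel_left]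

theorem proj_mul_simple (cs : CoxeterSystem A W) (J : Set B) (w : W) (s : B) :
    proj cs J (w * cs.simple s) = proj cs J w ∨
      ∃ c ∈ J, proj cs J (w * cs.simple s) = proj cs J w * cs.simple c ∧
        cs.simple c = (proj cs J w)⁻¹ * (w * cs.simple s * w⁻¹) * proj cs J w := by
  have hmin := isLeftMin_proj_inv_mul cs J w
  rcases hmin.mul_simple s with h | ⟨c, hc, h⟩
  · left
    exact proj_eq_of_isLeftMin cs (proj_mem cs J w) (by rwa [← mul_assoc])
  · right
    refine ⟨c, hc, proj_eq_of_isLeftMin cs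
      (mul_mem (proj_mem cs J w) (simple_mem_parabolic cs hc)) ?_, ?_⟩
    · rw [mul_inv_rev, mul_assoc, ← mul_assoc _ w, h, cs.inv_simple,
        cs.simple_mul_simple_cancel_left]
      exact hmin
    · rw [← mul_inv_eq_iff_eq_mul] at h
      rw [← h]
      group

/-- The union of the proper standard parabolic subgroups of `W_C`. -/
def properParabolics (cs : CoxeterSystem A W) (C : Set B) : Set W :=
  {w | ∃ c ∈ C, w ∈ parabolic cs (C \ {c})}

/-- The projection of a residue `w W_K` to `W_C` lies in a residue of a proper parabolic subgroup of
`W_C`, unless the face of type `K` containing `w` is fixed by `W_C`. -/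
theorem proj_residue (cs : CoxeterSystem A W) (C K : Set B) (w : W) {q : W}
    (hq : q ∈ parabolic cs K) :
    (proj cs C w)⁻¹ * proj cs C (w * q) ∈ properParabolics cs C ∨
      ∀ u ∈ parabolic cs C, w⁻¹ * u * w ∈ parabolic cs K := by
  set a := proj cs C w with ha
  set R : Subgroup W := (parabolic cs K).map (MulAut.conj (a⁻¹ * w)).toMonoidHom with hR
  have hmemR : ∀ x, x ∈ R ↔ (a⁻¹ * w)⁻¹ * x * (a⁻¹ * w) ∈ parabolic cs K := by
    intro x
    rw [hR, Subgroup.mem_map_equiv, MulAut.conj_symm_apply]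
  set L : Set B := {c ∈ C | cs.simple c ∈ R} with hL
  have hLR : parabolic cs L ≤ R := by
    rw [parabolic, Subgroup.closure_le]
    rintro _ ⟨c, hc, rfl⟩
    exact hc.2
  have hmem : a⁻¹ * proj cs C (w * q) ∈ parabolic cs L := by
    refine parabolic_induction_right cs hq
      (p := fun q => a⁻¹ * proj cs C (w * q) ∈ parabolic cs L) ?_ fun q hq s hs ih => ?_
    · rw [mul_one, ← ha, inv_mul_cancel]
      exact one_mem _
    · rw [← mul_assoc]
      rcases proj_mul_simple cs C (w * q) s with h | ⟨c, hc, h, h'⟩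
      · rwa [h]
      · rw [h, ← mul_assoc]
        refine mul_mem ih (simple_mem_parabolic cs (show c ∈ L from ⟨hc, ?_⟩))
        have h1 : (a⁻¹ * w) * (q * cs.simple s * q⁻¹) * (a⁻¹ * w)⁻¹ ∈ R := by
          rw [hmemR]
          have := mul_mem (mul_mem hq (simple_mem_parabolic cs hs)) (inv_mem hq)
          convert this using 1
          group
        have h2 := mul_mem (mul_mem (inv_mem (hLR ih)) h1) (hLR ih)
        rw [h']
        convert h2 using 1
        group
  by_cases hCL : C ⊆ L
  · right
    have hCR : parabolic cs C ≤ R := (parabolic_mono cs hCL).trans hLR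
    intro u hu
    have haC := proj_mem cs C w
    rw [← ha] at haC
    have := (hmemR _).mp (hCR (mul_mem (mul_mem (inv_mem haC) hu) haC))
    convert this using 1
    group
  · left
    obtain ⟨c, hc, hcL⟩ := Set.not_subset.mp hCL
    have hLc : L ⊆ C \ {c} := fun x hx => ⟨hx.1, fun h => hcL (h ▸ hx)⟩
    exact ⟨c, hc, parabolic_mono cs hLc hmem⟩

/-! ### Faces fixed by an infinite irreducible parabolic subgroup -/

/-- A case of Deodhar's theorem on conjugate parabolic subgroups: if `W_C` is infinite irreducible
and `m` is a further generator adjacent to `C`, then the residue `W_C` is the only residue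
`g W_K` of corank one in `W_{C ∪ {m}}` that is stabilized by `W_C`. -/
theorem mem_parabolic_of_conj_mem [Finite B] (cs : CoxeterSystem A W) {C : Set B}
    (hC : IsConnectedSet A C) (hinf : Infinite (parabolic cs C)) {a m : B} (ha : a ∈ C)
    (hm : m ∉ C) (ham : A a m ≠ 2) {g : W} (hg : g ∈ parabolic cs (insert m C)) {c : B}
    (hc : c ∈ insert m C)
    (hfix : ∀ u ∈ parabolic cs C, g⁻¹ * u * g ∈ parabolic cs (insert m C \ {c})) :
    g ∈ parabolic cs C ∧ c = m := by
  set K : Set B := insert m C \ {c} with hK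
  obtain ⟨b, hb, hmin⟩ := exists_isLeftMin cs K g⁻¹
  set h : W := b⁻¹ * g⁻¹ with hh
  have hfix' : ∀ u ∈ parabolic cs C, h * u * h⁻¹ ∈ parabolic cs K := by
    intro u hu
    have := mul_mem (mul_mem (inv_mem hb) (hfix u hu)) hb
    convert this using 1
    rw [hh]
    group
  -- Conjugation by `h` maps the generators in `C` to generators in `K`, bijectively by counting.
  have hgen : ∀ s ∈ C, ∃ k ∈ K, h * cs.simple s = cs.simple k * h := by
    intro s hs
    refine (hmin.mul_simple s).resolve_left fun hmin' => ?_
    have h1 := IsLeftMin.eq_one_of_mul (hfix' _ (simple_mem_parabolic cs hs)) hmin (by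
      rwa [inv_mul_cancel_right])
    exact simple_ne_one cs s (by simpa using h1)
  choose! σ hσK hσ using hgen
  have hinj : Set.InjOn σ C := by
    intro s hs t ht hst
    have := hσ s hs
    rw [hst, ← hσ t ht] at this
    exact simple_injective cs (mul_left_cancel this)
  have hcard : K.ncard ≤ C.ncard := by
    rw [hK, Set.ncard_sdiff_singleton_of_mem hc, Set.ncard_insert_of_notMem hm]
    simp
  have hsurj : ∀ k ∈ K, ∃ s ∈ C, σ s = k := by
    intro k hk
    have h1 : σ '' C = K := Set.eq_of_subset_of_ncard_le
      (Set.image_subset_iff.mpr hσK) (by rwa [hinj.ncard_image])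
    exact (Set.mem_image _ _ _).mp (h1 ▸ hk)
  have hback : ∀ x ∈ parabolic cs K, h⁻¹ * x * h ∈ parabolic cs C := by
    intro x hx
    refine parabolic_induction_right cs hx (p := fun x => h⁻¹ * x * h ∈ parabolic cs C)
      (by simp) fun x _ k hk ih => ?_
    obtain ⟨s, hs, rfl⟩ := hsurj k hk
    have h1 := mul_mem ih (simple_mem_parabolic cs hs)
    rwa [mul_assoc, hσ s hs, ← mul_assoc, mul_assoc h⁻¹] at h1
  -- The inversions of `h⁻¹` outside `W_C` are permuted by `W_C`.
  have hstable : ∀ u ∈ parabolic cs C, ∀ r ∈ inversions cs h⁻¹, r ∉ parabolic cs C →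
      u * r * u⁻¹ ∈ inversions cs h⁻¹ := by
    intro u hu r hr hrC
    have hr' : u * r * u⁻¹ ∉ parabolic cs C := fun h1 => hrC (by
      have := mul_mem (mul_mem (inv_mem hu) h1) hu
      convert this using 1
      group)
    have e : u * h⁻¹ = h⁻¹ * (h * u * h⁻¹) := by group
    have h1 : u * r * u⁻¹ ∈ inversions cs (u * h⁻¹) := by
      rw [mem_inversions_mul]
      refine Or.inr ⟨?_, fun h2 => hr' (inversions_subset_parabolic cs hu h2)⟩
      convert hr using 1
      group
    rw [e, mem_inversions_mul] at h1
    rcases h1 with h1 | h1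
    · exact h1.1
    · refine (hr' ?_).elim
      have := hback _ (inversions_subset_parabolic cs (hfix' u hu) h1.1)
      convert this using 1
      group
  have hCJ : parabolic cs C ≤ parabolic cs (insert m C) :=
    parabolic_mono cs (Set.subset_insert m C)
  have hKJ : parabolic cs K ≤ parabolic cs (insert m C) := parabolic_mono cs Set.sdiff_subset
  have hmC : cs.simple m ∉ parabolic cs C := fun h1 => hm ((simple_mem_parabolic_iff cs).mp h1)
  have hhC : h⁻¹ ∈ parabolic cs C := by
    set p := proj cs C h⁻¹ with hp
    have hpC : p ∈ parabolic cs C := proj_mem cs C h⁻¹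
    have hpmin := isLeftMin_proj_inv_mul cs C h⁻¹
    rw [← hp] at hpmin
    by_cases h1 : p⁻¹ * h⁻¹ = 1
    · rwa [← eq_of_inv_mul_eq_one h1]
    exfalso
    have hhJ : h⁻¹ ∈ parabolic cs (insert m C) := by
      rw [hh, mul_inv_rev, inv_inv, inv_inv]
      exact mul_mem hg (hKJ hb)
    obtain ⟨j, hj, hjN⟩ := exists_simple_mem_inversions cs
      (mul_mem (inv_mem (hCJ hpC)) hhJ) h1
    have hjC : j ∉ C := fun hjC => hpmin _ (simple_mem_parabolic cs hjC) hjN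
    obtain rfl : j = m := hj.resolve_right hjC
    have hr : p * cs.simple j * p⁻¹ ∉ parabolic cs C := fun h2 => hmC (by
      have := mul_mem (mul_mem (inv_mem hpC) h2) hpC
      convert this using 1
      group)
    have hrN : p * cs.simple j * p⁻¹ ∈ inversions cs h⁻¹ := by
      have e : h⁻¹ = p * (p⁻¹ * h⁻¹) := by group
      rw [e, mem_inversions_mul]
      refine Or.inr ⟨?_, fun h2 => hr (inversions_subset_parabolic cs hpC h2)⟩
      convert hjN using 1
      group
    -- So the reflection of `m` has finitely many conjugates under `W_C`.
    refine not_finite_iff_infinite.mpr hinf (finite_parabolic_of_finite_range cs hC ha hm ham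
      (fun u => (u : W) * cs.simple j * (u : W)⁻¹)
      ((finite_inversions cs h⁻¹).subset ?_) ?_)
    · rintro _ ⟨u, rfl⟩
      have := hstable (u * p⁻¹) (mul_mem u.2 (inv_mem hpC)) _ hrN hr
      convert this using 1
      group
    · intro u v huv
      simp only [Subgroup.coe_mul, Subgroup.coe_inv]
      have h2 : cs.simple j = (u : W)⁻¹ * ((v : W) * cs.simple j * (v : W)⁻¹) * u := by
        rw [← huv]; group
      calc cs.simple j * ((u : W)⁻¹ * v)
          = (u : W)⁻¹ * ((v : W) * cs.simple j * (v : W)⁻¹) * u * ((u : W)⁻¹ * v) := by rw [← h2]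
        _ = (u : W)⁻¹ * v * cs.simple j := by group
  have hhC' : h ∈ parabolic cs C := by simpa using inv_mem hhC
  have hKC : K ⊆ C := by
    intro k hk
    have h1 := mul_mem (mul_mem hhC' (hback _ (simple_mem_parabolic cs hk))) hhC
    rw [← simple_mem_parabolic_iff cs]
    convert h1 using 1
    group
  have hcm : c = m := by
    by_contra hne
    exact hm (hKC ⟨Set.mem_insert m C, fun h1 => hne h1.symm⟩)
  refine ⟨?_, hcm⟩
  have : g = h⁻¹ * b⁻¹ := by rw [hh]; group
  rw [this]
  exact mul_mem hhC (inv_mem (parabolic_mono cs hKC hb))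

/-! ### Products of proper parabolic subgroups -/

open scoped Pointwise

theorem inv_mem_pow_properParabolics (cs : CoxeterSystem A W) {C : Set B} {n : ℕ} {w : W}
    (hw : w ∈ properParabolics cs C ^ n) : w⁻¹ ∈ properParabolics cs C ^ n := by
  have hinv : (properParabolics cs C)⁻¹ = properParabolics cs C := by
    ext x
    simp [properParabolics]
  rw [← Set.mem_inv, ← inv_pow, hinv]
  exact hw

theorem one_mem_properParabolics (cs : CoxeterSystem A W) {C : Set B} (hC : C.Nonempty) :
    (1 : W) ∈ properParabolics cs C :=
  let ⟨c, hc⟩ := hC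
  ⟨c, hc, one_mem _⟩

theorem pow_properParabolics_mono (cs : CoxeterSystem A W) {C : Set B} (hC : C.Nonempty)
    {i j : ℕ} (h : i ≤ j) : properParabolics cs C ^ i ⊆ properParabolics cs C ^ j :=
  Set.pow_subset_pow_right (one_mem_properParabolics cs hC) h

theorem exists_ne_of_infinite_parabolic (cs : CoxeterSystem A W) {C : Set B}
    (hinf : Infinite (parabolic cs C)) (c : B) : ∃ d ∈ C, d ≠ c := by
  by_contra! h
  have hfin : (parabolic cs C : Set W).Finite := by
    refine (Set.toFinite {1, cs.simple c}).subset fun w hw => ?_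
    refine parabolic_induction_right cs hw (p := fun w => w ∈ ({1, cs.simple c} : Set W))
      (by simp) fun w _ s hs ih => ?_
    rw [h s hs]
    rcases ih with rfl | rfl <;> simp
  exact not_finite_iff_infinite.mpr hinf hfin.to_subtype

theorem exists_mem_pow_properParabolics (cs : CoxeterSystem A W) {C : Set B}
    (hinf : Infinite (parabolic cs C)) {w : W} (hw : w ∈ parabolic cs C) :
    ∃ n, w ∈ properParabolics cs C ^ n := by
  refine parabolic_induction_right cs hw (p := fun w => ∃ n, w ∈ properParabolics cs C ^ n)
    ⟨0, by simp⟩ fun w _ s hs ih => ?_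
  obtain ⟨n, hn⟩ := ih
  obtain ⟨d, hd, hds⟩ := exists_ne_of_infinite_parabolic cs hinf s
  exact ⟨n + 1, by
    rw [pow_succ]
    exact Set.mul_mem_mul hn ⟨d, hd, simple_mem_parabolic cs ⟨hs, hds.symm⟩⟩⟩

/-- A path of proper residues of `W_{C ∪ {m}}` from `g` to `g q` either avoids the vertex fixed by
`W_C`, and then projects to a path of proper residues of `W_C`, or it passes through that vertex
and is cut in two there. -/
theorem proj_mem_pow_or_exists_split [Finite B] (cs : CoxeterSystem A W) {C : Set B}
    (hC : IsConnectedSet A C) (hinf : Infinite (parabolic cs C)) {a m : B} (ha : a ∈ C)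
    (hm : m ∉ C) (ham : A a m ≠ 2) (k : ℕ) {g q : W} (hg : g ∈ parabolic cs (insert m C))
    (hq : q ∈ properParabolics cs (insert m C) ^ k) :
    (proj cs C g)⁻¹ * proj cs C (g * q) ∈ properParabolics cs C ^ k ∨
      ∃ i j, i + j + 1 = k ∧ ∃ x ∈ parabolic cs C, ∃ y ∈ parabolic cs C,
        g⁻¹ * x ∈ properParabolics cs (insert m C) ^ i ∧
          y⁻¹ * (g * q) ∈ properParabolics cs (insert m C) ^ j := by
  induction k generalizing g q with
  | zero =>
    left
    rw [pow_zero, Set.mem_one] at hq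
    simp [hq]
  | succ k ih =>
    rw [pow_succ'] at hq
    obtain ⟨q₁, hq₁, q₂, hq₂, rfl⟩ := Set.mem_mul.mp hq
    obtain ⟨c, hc, hq₁c⟩ := id hq₁
    rcases proj_residue cs C (insert m C \ {c}) g hq₁c with h | h
    · have hgq : g * q₁ ∈ parabolic cs (insert m C) :=
        mul_mem hg (parabolic_mono cs Set.sdiff_subset hq₁c)
      rcases ih hgq hq₂ with h' | ⟨i, j, hij, x, hx, y, hy, h1, h2⟩
      · left
        have := Set.mul_mem_mul h h'
        rw [← pow_succ'] at this
        convert this using 1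
        simp [mul_assoc]
      · refine Or.inr ⟨i + 1, j, by omega, x, hx, y, hy, ?_, by rwa [← mul_assoc g]⟩
        have := Set.mul_mem_mul hq₁ h1
        rw [← pow_succ'] at this
        convert this using 1
        simp [mul_assoc]
    · obtain ⟨hgC, rfl⟩ := mem_parabolic_of_conj_mem cs hC hinf ha hm ham hg hc h
      rw [Set.insert_sdiff_self_of_notMem hm] at hq₁c
      refine Or.inr ⟨0, k, by omega, g, hgC, g * q₁, mul_mem hgC hq₁c, by simp, ?_⟩
      convert hq₂ using 1
      group

/-- Far out in `W_C`, an element `u` of `W_C` moves `w` so far that every path of proper residues of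
`W_{C ∪ {m}}` from `w` to `u w` passes through the vertex fixed by `W_C`; so `w` is within about
half the length of the path from that vertex. -/
theorem mem_pow_of_conj_mem_pow [Finite B] (cs : CoxeterSystem A W) {C : Set B}
    (hC : IsConnectedSet A C) (hinf : Infinite (parabolic cs C)) {a m : B} (ha : a ∈ C)
    (hm : m ∉ C) (ham : A a m ≠ 2) {w : W} (hw : w ∈ parabolic cs (insert m C)) (k : ℕ) :
    ∃ N, ∀ u ∈ parabolic cs C, w⁻¹ * u * w ∈ properParabolics cs (insert m C) ^ k →
      u ∈ properParabolics cs C ^ N ∨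
      ∃ i j, i + j + 1 = k ∧ w ∈ properParabolics cs (insert m C) ^ (i + 1) ∧
        w ∈ properParabolics cs (insert m C) ^ (j + 1) := by
  obtain ⟨n, hn⟩ := exists_mem_pow_properParabolics cs hinf (proj_mem cs C w)
  have hCQ : (parabolic cs C : Set W) ⊆ properParabolics cs (insert m C) := fun x hx =>
    ⟨m, Set.mem_insert m C, by rwa [Set.insert_sdiff_self_of_notMem hm]⟩
  refine ⟨n + k + n, fun u hu h => ?_⟩
  rcases proj_mem_pow_or_exists_split cs hC hinf ha hm ham k hw h with
    h | ⟨i, j, hij, x, hx, y, hy, h1, h2⟩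
  · left
    have e : w * (w⁻¹ * u * w) = u * w := by group
    rw [e, proj_mul cs hu] at h
    rw [pow_add, pow_add]
    have := Set.mul_mem_mul (Set.mul_mem_mul hn h) (inv_mem_pow_properParabolics cs hn)
    convert this using 1
    group
  · refine Or.inr ⟨i, j, hij, ?_, ?_⟩
    · rw [pow_succ']
      have := Set.mul_mem_mul (hCQ hx) (inv_mem_pow_properParabolics cs h1)
      convert this using 1
      group
    · rw [pow_succ']
      have := Set.mul_mem_mul (hCQ (mul_mem (inv_mem hu) hy)) h2
      convert this using 1
      group

theorem mem_of_wordProd_mem_parabolic (cs : CoxeterSystem A W) {K : Set B} {ω : List B}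
    (hω : ω.Nodup) (h : cs.wordProd ω ∈ parabolic cs K) : ∀ s ∈ ω, s ∈ K := by
  induction ω with
  | nil => simp
  | cons s ω ih =>
    rw [List.nodup_cons] at hω
    rw [cs.wordProd_cons] at h
    have hsK : s ∈ K := by
      have h1 : cs.simple s * cs.wordProd ω * (cs.wordProd ω)⁻¹ ∈ parabolic cs (K ∪ {t | t ∈ ω}) :=
        mul_mem (parabolic_mono cs Set.subset_union_left h)
          (inv_mem (wordProd_mem_parabolic cs fun t ht => Or.inr ht))
      rw [mul_inv_cancel_right, simple_mem_parabolic_iff] at h1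
      exact h1.resolve_right hω.1
    have h2 := mul_mem (simple_mem_parabolic cs hsK) h
    rw [cs.simple_mul_simple_cancel_left] at h2
    simpa [hsK] using ih hω.2 h2

/-- A Coxeter element lies in no proper standard parabolic subgroup. -/
theorem not_parabolic_subset_properParabolics [Finite B] (cs : CoxeterSystem A W) (C : Set B) :
    ¬ (parabolic cs C : Set W) ⊆ properParabolics cs C := by
  intro h
  set ω := C.toFinite.toFinset.toList with hω
  have hmem : ∀ s, s ∈ ω ↔ s ∈ C := by simp [hω]
  obtain ⟨c, hc, hc'⟩ := h (wordProd_mem_parabolic cs fun s hs => (hmem s).mp hs)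
  exact (mem_of_wordProd_mem_parabolic cs (Finset.nodup_toList _) hc' c ((hmem c).mpr hc)).2 rfl

theorem finite_pow {s : Set W} (hs : s.Finite) (n : ℕ) : (s ^ n).Finite := by
  induction n with
  | zero => simp
  | succ n ih => rw [pow_succ]; exact ih.mul hs

/-- The doubling argument: if every element of `W_{C ∪ {m}}` is a product of `n ≥ 2` elements of
proper parabolic subgroups, then `n` can be decreased, since for `u ∈ W_C` far out a shortest path
of residues from `w` to `u w` is about twice as long as one from `w` to `1`. -/
theorem not_parabolic_insert_subset_pow [Finite B] (cs : CoxeterSystem A W) {C : Set B}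
    (hC : IsConnectedSet A C) (hinf : Infinite (parabolic cs C)) {a m : B} (ha : a ∈ C)
    (hm : m ∉ C) (ham : A a m ≠ 2)
    (hub : ∀ n, ¬ (parabolic cs C : Set W) ⊆ properParabolics cs C ^ n) (n : ℕ) :
    ¬ (parabolic cs (insert m C) : Set W) ⊆ properParabolics cs (insert m C) ^ n := by
  have hne : (insert m C).Nonempty := Set.insert_nonempty m C
  have hCJ : parabolic cs C ≤ parabolic cs (insert m C) :=
    parabolic_mono cs (Set.subset_insert m C)
  induction n using Nat.strong_induction_on with
  | _ n ih =>
    intro h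
    rcases Nat.lt_or_ge n 2 with h2 | h2
    · refine not_parabolic_subset_properParabolics cs (insert m C) ?_
      have := h.trans (pow_properParabolics_mono cs hne (show n ≤ 1 by omega))
      rwa [pow_one] at this
    · refine ih (n - 1) (by omega) fun w hw => ?_
      obtain ⟨N, hN⟩ := mem_pow_of_conj_mem_pow cs hC hinf ha hm ham hw n
      obtain ⟨u, hu, huN⟩ := Set.not_subset.mp (hub N)
      rcases hN u hu (h (mul_mem (mul_mem (inv_mem hw) (hCJ hu)) hw)) with
        h1 | ⟨i, j, hij, h1, h2⟩
      · exact (huN h1).elim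
      · rcases le_total i j with hle | hle
        · exact pow_properParabolics_mono cs hne (by omega) h1
        · exact pow_properParabolics_mono cs hne (by omega) h2

/-- An infinite irreducible Coxeter group is not a bounded product of its proper standard parabolic
subgroups. -/
theorem not_parabolic_subset_pow [Finite B] (cs : CoxeterSystem A W) {C : Set B}
    (hC : IsConnectedSet A C) (hinf : Infinite (parabolic cs C)) (n : ℕ) :
    ¬ (parabolic cs C : Set W) ⊆ properParabolics cs C ^ n := by
  induction C using WellFoundedLT.induction generalizing n with
  | _ C ih =>
    by_cases hex : ∃ K, K ⊂ C ∧ IsConnectedSet A K ∧ Infinite (parabolic cs K)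
    · obtain ⟨K₀, hK₀⟩ := hex
      obtain ⟨K, -, hK⟩ := exists_maximal_ge_of_wellFoundedGT
        (fun K : Set B => K ⊂ C ∧ IsConnectedSet A K ∧ Infinite (parabolic cs K)) K₀ hK₀
      obtain ⟨hKC, hKconn, hKinf⟩ := hK.prop
      have hKne : K.Nonempty := nonempty_of_infinite_parabolic cs hKinf
      obtain ⟨a, ha, m, hm, ham⟩ := hC K hKC.subset hKne hKC.ne
      have hins : insert m K ⊆ C := Set.insert_subset hm.1 hKC.subset
      have hCeq : insert m K = C := by
        by_contra hne
        have hinf' : Infinite (parabolic cs (insert m K)) :=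
          Infinite.of_injective _
            (Subgroup.inclusion_injective (parabolic_mono cs (Set.subset_insert m K)))
        have h1 := hK.eq_of_le (y := insert m K)
          ⟨hins.ssubset_of_ne hne, hKconn.insert ha hm.2 ham, hinf'⟩ (Set.subset_insert m K)
        exact hm.2 (h1 ▸ Set.mem_insert m K)
      rw [← hCeq]
      exact not_parabolic_insert_subset_pow cs hKconn hKinf ha hm.2 ham
        (ih K hKC hKconn hKinf) n
    · push Not at hex
      intro h
      have hfin : (properParabolics cs C).Finite := by
        have e : properParabolics cs C = ⋃ c ∈ C, (parabolic cs (C \ {c}) : Set W) := by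
          ext x
          simp [properParabolics]
        rw [e]
        refine C.toFinite.biUnion fun c hc => ?_
        by_contra hcon
        obtain ⟨K, hK, hKconn, hKinf⟩ := exists_isConnectedSet_infinite cs (D := C \ {c})
          (Set.infinite_coe_iff.mpr hcon)
        refine not_finite_iff_infinite.mpr hKinf (hex K ?_ hKconn)
        exact ⟨hK.trans Set.sdiff_subset, fun h' => (hK (h' hc)).2 rfl⟩
      exact not_finite_iff_infinite.mpr hinf
        ((finite_pow hfin n).subset h).to_subtype

/-! ### Geodesic distances and words -/

theorem cayleyGraph_dist_mul_wordProd_le (cs : CoxeterSystem A W) (w : W) (ω : List B) :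
    (cayleyGraph cs).dist w (w * cs.wordProd ω) ≤ ω.length := by
  induction ω generalizing w with
  | nil => simp
  | cons s ω ih =>
    have h1 : (cayleyGraph cs).dist w (w * cs.simple s) = 1 := by
      rw [SimpleGraph.dist_eq_one_iff_adj, cayleyGraph, SimpleGraph.mulCayley_adj']
      exact ⟨fun h => simple_ne_one cs s (by simpa using h), _, ⟨s, rfl⟩, Or.inl rfl⟩
    have h2 := (cayleyGraph_connected cs).dist_triangle (u := w) (v := w * cs.simple s)
      (w := w * cs.simple s * cs.wordProd ω)
    have h3 := ih (w * cs.simple s)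
    rw [cs.wordProd_cons, ← mul_assoc, List.length_cons]
    omega

theorem cayleyGraph_dist_le_length (cs : CoxeterSystem A W) (w w' : W) :
    (cayleyGraph cs).dist w w' ≤ cs.length (w⁻¹ * w') := by
  obtain ⟨ω, hω, h⟩ := cs.exists_isReduced (w⁻¹ * w')
  have := cayleyGraph_dist_mul_wordProd_le cs w ω
  rwa [← h, mul_inv_cancel_left, ← hω.eq, ← h] at this

theorem exists_word_of_cayleyGraph_dist (cs : CoxeterSystem A W) (w w' : W) :
    ∃ ω : List B, ω.length = (cayleyGraph cs).dist w w' ∧ w' = w * cs.wordProd ω := by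
  obtain ⟨p, hp⟩ := (cayleyGraph_connected cs).exists_walk_length_eq_dist w w'
  rw [← hp]
  clear hp
  induction p with
  | nil => exact ⟨[], by simp⟩
  | cons h p ih =>
    obtain ⟨ω, h1, h2⟩ := ih
    rw [cayleyGraph, SimpleGraph.mulCayley_adj'] at h
    obtain ⟨-, _, ⟨s, rfl⟩, h | h⟩ := h
    · exact ⟨s :: ω, by simp [h1], by rw [cs.wordProd_cons, ← mul_assoc, h, h2]⟩
    · refine ⟨s :: ω, by simp [h1], ?_⟩
      rw [cs.wordProd_cons, h, ← mul_assoc, cs.simple_mul_simple_cancel_right, h2]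

theorem finite_cayleyGraph_ball [Finite B] (cs : CoxeterSystem A W) (w : W) (n : ℕ) :
    {w' | (cayleyGraph cs).dist w w' ≤ n}.Finite := by
  refine ((List.finite_length_le B n).image fun ω => w * cs.wordProd ω).subset fun w' hw' => ?_
  obtain ⟨ω, h1, h2⟩ := exists_word_of_cayleyGraph_dist cs w w'
  exact ⟨ω, h1.le.trans hw', h2.symm⟩

theorem skeleton_dist_le_cayleyGraph_dist (cs : CoxeterSystem A W) (M : Set B) (w w' : W) :
    (skeleton cs M).dist (chamberVertex cs M w) (chamberVertex cs M w') ≤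
      (cayleyGraph cs).dist w w' := by
  obtain ⟨ω, h1, rfl⟩ := exists_word_of_cayleyGraph_dist cs w w'
  rw [← h1]
  clear h1
  induction ω generalizing w with
  | nil => simp
  | cons s ω ih =>
    have h1 : (skeleton cs M).dist (chamberVertex cs M w) (chamberVertex cs M (w * cs.simple s)) ≤
        1 := by
      by_cases h : chamberVertex cs M w = chamberVertex cs M (w * cs.simple s)
      · rw [← h, SimpleGraph.dist_self]; omega
      · have hadj : (skeleton cs M).Adj (chamberVertex cs M w)
            (chamberVertex cs M (w * cs.simple s)) := ⟨h, w, s, rfl, rfl⟩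
        exact (SimpleGraph.dist_eq_one_iff_adj.mpr hadj).le
    have h2 := (skeleton_connected cs M).dist_triangle (u := chamberVertex cs M w)
      (v := chamberVertex cs M (w * cs.simple s))
      (w := chamberVertex cs M (w * cs.simple s * cs.wordProd ω))
    have h3 := ih (w * cs.simple s)
    rw [cs.wordProd_cons, ← mul_assoc, List.length_cons]
    omega

/-- `W` acts on the skeleton by automorphisms. -/
theorem skeleton_dist_smul_le (cs : CoxeterSystem A W) (M : Set B) (g : W) (v v' : Vertex cs M) :
    (skeleton cs M).dist (g • v) (g • v') ≤ (skeleton cs M).dist v v' := by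
  let φ : skeleton cs M →g skeleton cs M :=
    { toFun := fun v => g • v
      map_rel' := by
        rintro _ _ ⟨h, w, s, rfl, rfl⟩
        exact ⟨fun h' => h (smul_left_cancel g h'), g * w, s, rfl, by rw [mul_assoc]; rfl⟩ }
  obtain ⟨p, hp⟩ := (skeleton_connected cs M).exists_walk_length_eq_dist v v'
  rw [← hp, ← p.length_map φ]
  exact SimpleGraph.dist_le _

theorem chamberVertex_eq_iff (cs : CoxeterSystem A W) (M : Set B) (w w' : W) :
    chamberVertex cs M w = chamberVertex cs M w' ↔ w⁻¹ * w' ∈ parabolic cs Mᶜ :=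
  QuotientGroup.eq

open Classical in
/-- A geodesic of the skeleton from `w x₀` to `w' x₀` yields a word for `w⁻¹ w'` whose letters
in `M` are at most as many as its edges: turning about a vertex takes letters outside `M` only. -/
theorem exists_word_of_skeleton_dist (cs : CoxeterSystem A W) (M : Set B) (w w' : W) :
    ∃ ω : List B, cs.wordProd ω = w⁻¹ * w' ∧ ω.countP (· ∈ M) ≤
      (skeleton cs M).dist (chamberVertex cs M w) (chamberVertex cs M w') := by
  have hpar : ∀ {h : W}, h ∈ parabolic cs Mᶜ →
      ∃ ω : List B, cs.wordProd ω = h ∧ ω.countP (· ∈ M) = 0 := by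
    intro h hh
    obtain ⟨ω, h1, rfl⟩ := exists_word_of_mem_parabolic cs hh
    exact ⟨ω, rfl, List.countP_eq_zero.mpr fun s hs => by simpa using h1 s hs⟩
  obtain ⟨p, hp⟩ := (skeleton_connected cs M).exists_walk_length_eq_dist
    (chamberVertex cs M w) (chamberVertex cs M w')
  rw [← hp]
  clear hp
  generalize hv : chamberVertex cs M w = v, hv' : chamberVertex cs M w' = v' at p
  induction p generalizing w with
  | nil =>
    obtain ⟨ω, h1, h2⟩ := hpar ((chamberVertex_eq_iff cs M w w').mp (hv.trans hv'.symm))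
    exact ⟨ω, h1, by simp [h2]⟩
  | cons h p ih =>
    obtain ⟨-, g, s, h1, h2⟩ := id h
    obtain ⟨ω₁, h3, h4⟩ := hpar ((chamberVertex_eq_iff cs M w g).mp (hv.trans h1))
    obtain ⟨ω₂, h5, h6⟩ := ih (g * cs.simple s) h2.symm hv'
    refine ⟨ω₁ ++ s :: ω₂, ?_, ?_⟩
    · rw [cs.wordProd_append, cs.wordProd_cons, h3, h5, mul_inv_rev, cs.inv_simple]
      simp [mul_assoc]
    · rw [List.countP_append, h4, List.countP_cons, SimpleGraph.Walk.length_cons]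
      split_ifs <;> omega

/-! ### Finite vertex stabilizers -/

/-- If the lengths of the elements of `W_{S ∖ M}` are at most `D`, then `d_S` is bounded in terms of
`d_X`: a word with `n` letters in `M` has `n + 1` blocks of letters in `S ∖ M`. -/
theorem cayleyGraph_dist_le_skeleton_dist (cs : CoxeterSystem A W) (M : Set B) {D : ℕ}
    (hD : ∀ u ∈ parabolic cs Mᶜ, cs.length u ≤ D) (w w' : W) :
    (cayleyGraph cs).dist w w' ≤
      (D + 1) * (skeleton cs M).dist (chamberVertex cs M w) (chamberVertex cs M w') + D := by
  classical
  have key : ∀ ω : List B, ∃ h ∈ parabolic cs Mᶜ,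
      cs.length (h⁻¹ * cs.wordProd ω) ≤ (D + 1) * ω.countP (· ∈ M) := by
    intro ω
    induction ω with
    | nil => exact ⟨1, one_mem _, by simp⟩
    | cons s ω ih =>
      obtain ⟨h, hh, hle⟩ := ih
      by_cases hs : s ∈ M
      · refine ⟨1, one_mem _, ?_⟩
        have h1 := cs.length_mul_le (cs.simple s) (h * (h⁻¹ * cs.wordProd ω))
        have h2 := cs.length_mul_le h (h⁻¹ * cs.wordProd ω)
        have h3 := hD h hh
        rw [cs.length_simple] at h1
        rw [mul_inv_cancel_left] at h1 h2
        rw [List.countP_cons_of_pos (by simpa using hs), inv_one, one_mul, cs.wordProd_cons]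
        linarith
      · refine ⟨cs.simple s * h, mul_mem (simple_mem_parabolic cs hs) hh, ?_⟩
        rw [List.countP_cons_of_neg (by simpa using hs), cs.wordProd_cons, mul_inv_rev,
          cs.inv_simple, mul_assoc, cs.simple_mul_simple_cancel_left]
        exact hle
  obtain ⟨ω, hω, hcount⟩ := exists_word_of_skeleton_dist cs M w w'
  obtain ⟨h, hh, hle⟩ := key ω
  rw [hω] at hle
  have h1 := cayleyGraph_dist_le_length cs w w'
  have h2 := cs.length_mul_le h (h⁻¹ * (w⁻¹ * w'))
  rw [mul_inv_cancel_left] at h2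
  have h3 := hD h hh
  have h4 := Nat.mul_le_mul_left (D + 1) hcount
  linarith

theorem exists_length_maximal (cs : CoxeterSystem A W) (J : Set B)
    (hfin : Finite (parabolic cs J)) :
    ∃ w₀ ∈ parabolic cs J, ∀ u ∈ parabolic cs J, cs.length u ≤ cs.length w₀ :=
  Set.exists_max_image (parabolic cs J : Set W) cs.length (Set.toFinite _) ⟨1, one_mem _⟩

theorem isQuasiIsometry_chamberVertex (cs : CoxeterSystem A W) (M : Set B)
    (hfin : Finite (parabolic cs Mᶜ)) :
    IsQuasiIsometry (cayleyGraph cs) (skeleton cs M) (chamberVertex cs M) := by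
  obtain ⟨w₀, -, hw₀⟩ := exists_length_maximal cs Mᶜ hfin
  set D := cs.length w₀
  refine ⟨D + 1, D, 0, by simp, by positivity, le_rfl, fun w w' => ⟨?_, ?_⟩, fun y => ?_⟩
  · have h : ((cayleyGraph cs).dist w w' : ℝ) ≤ (D + 1) *
        (skeleton cs M).dist (chamberVertex cs M w) (chamberVertex cs M w') + D := by
      exact_mod_cast cayleyGraph_dist_le_skeleton_dist cs M hw₀ w w'
    rw [← mul_sub, inv_mul_le_iff₀ (by positivity)]
    linarith
  · have h : ((skeleton cs M).dist (chamberVertex cs M w) (chamberVertex cs M w') : ℝ) ≤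
        (cayleyGraph cs).dist w w' := by
      exact_mod_cast skeleton_dist_le_cayleyGraph_dist cs M w w'
    have h1 : (0 : ℝ) ≤ D * (cayleyGraph cs).dist w w' := by positivity
    have h2 : (0 : ℝ) ≤ D := by positivity
    linarith
  · obtain ⟨w, rfl⟩ := QuotientGroup.mk_surjective y
    exact ⟨w, by simp [chamberVertex]⟩

/-- A section of the map from chambers to vertices is a quasi-inverse. -/
theorem quasiIsometric_skeleton_cayleyGraph (cs : CoxeterSystem A W) (M : Set B)
    (hfin : Finite (parabolic cs Mᶜ)) : QuasiIsometric (skeleton cs M) (cayleyGraph cs) := by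
  obtain ⟨w₀, -, hw₀⟩ := exists_length_maximal cs Mᶜ hfin
  set D := cs.length w₀
  have hout : ∀ v : Vertex cs M, chamberVertex cs M v.out = v := QuotientGroup.out_eq'
  have hD : (0 : ℝ) ≤ D := by positivity
  refine ⟨Quotient.out, D + 1, D, D, by simp, hD, hD, fun v v' => ⟨?_, ?_⟩, fun w => ?_⟩
  · have h := skeleton_dist_le_cayleyGraph_dist cs M v.out v'.out
    rw [hout, hout] at h
    have h' : ((skeleton cs M).dist v v' : ℝ) ≤ (cayleyGraph cs).dist v.out v'.out := by
      exact_mod_cast h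
    have h1 : (0 : ℝ) ≤ D * (cayleyGraph cs).dist v.out v'.out := by positivity
    rw [← mul_sub, inv_mul_le_iff₀ (by positivity)]
    linarith
  · have h := cayleyGraph_dist_le_skeleton_dist cs M hw₀ v.out v'.out
    rw [hout, hout] at h
    exact_mod_cast h
  · refine ⟨chamberVertex cs M w, ?_⟩
    have h := cayleyGraph_dist_le_skeleton_dist cs M hw₀ w (chamberVertex cs M w).out
    rw [hout, SimpleGraph.dist_self, mul_zero, zero_add] at h
    exact_mod_cast h

theorem hasFiniteVertexLinks_of_finite [Finite B] (cs : CoxeterSystem A W) (M : Set B)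
    (hfin : Finite (parabolic cs Mᶜ)) : HasFiniteVertexLinks cs M := by
  intro v
  obtain ⟨g, rfl⟩ := QuotientGroup.mk_surjective v
  refine Set.Finite.of_finite_image (f := Subtype.val) ?_ Subtype.val_injective.injOn
  refine (Set.Finite.image2 (fun h J => faceSet cs M (g * h) J)
    (Set.toFinite (parabolic cs Mᶜ : Set W)) (Set.toFinite (Set.univ : Set (Set B)))).subset ?_
  rintro _ ⟨⟨F, hF⟩, hFv, rfl⟩
  have hgF : chamberVertex cs M g ∈ F := hFv.1 (Set.mem_singleton _)
  rcases hF with rfl | ⟨w, J, rfl⟩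
  · exact hgF.elim
  obtain ⟨u, hu, hgu⟩ := hgF
  rw [chamberVertex_eq_iff] at hgu
  refine ⟨g⁻¹ * (w * u), hgu, J, Set.mem_univ J, ?_⟩
  simp only [mul_inv_cancel_left]
  ext v
  constructor
  · rintro ⟨x, hx, rfl⟩
    exact ⟨u * x, mul_mem hu hx, by rw [mul_assoc]⟩
  · rintro ⟨x, hx, rfl⟩
    exact ⟨u⁻¹ * x, mul_mem (inv_mem hu) hx, by rw [mul_assoc, mul_inv_cancel_left]⟩

/-! ### Infinite vertex stabilizers -/

/-- If `W_{S ∖ M}` is infinite, it has an infinite irreducible standard parabolic subgroup `W_C`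
with `C` adjacent to `M`; this is where components of the diagram that avoid `M` are to be excluded. -/
theorem exists_connected_adjacent [Finite B] (cs : CoxeterSystem A W) (M : Set B)
    (hM : Finite (parabolic cs {s : B | ∀ t ∈ M, ¬ (coxeterDiagram A).Reachable t s}))
    (hinf : Infinite (parabolic cs Mᶜ)) :
    ∃ C ⊆ Mᶜ, IsConnectedSet A C ∧ Infinite (parabolic cs C) ∧
      ∃ a ∈ C, ∃ m ∈ M, A a m ≠ 2 := by
  obtain ⟨K, hKM, hK, hKinf⟩ := exists_isConnectedSet_infinite cs hinf
  obtain ⟨C, -, hC⟩ := exists_maximal_ge_of_wellFoundedGT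
    (fun K : Set B => K ⊆ Mᶜ ∧ IsConnectedSet A K ∧ Infinite (parabolic cs K)) K ⟨hKM, hK, hKinf⟩
  obtain ⟨hCM, hCconn, hCinf⟩ := hC.prop
  refine ⟨C, hCM, hCconn, hCinf, ?_⟩
  by_contra! hcon
  -- A maximal `C` without neighbours in `M` is a connected component.
  have hclosed : ∀ x ∈ C, ∀ y, (coxeterDiagram A).Adj x y → y ∈ C := by
    intro x hx y hxy
    by_contra hy
    have hyM : y ∉ M := fun h => hxy.2 (hcon x hx y h)
    have hinf' : Infinite (parabolic cs (insert y C)) :=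
      Infinite.of_injective _
        (Subgroup.inclusion_injective (parabolic_mono cs (Set.subset_insert y C)))
    have h1 := hC.eq_of_le (y := insert y C)
      ⟨Set.insert_subset hyM hCM, hCconn.insert hx hy hxy.2, hinf'⟩ (Set.subset_insert y C)
    exact hy (h1 ▸ Set.mem_insert y C)
  have hreach : ∀ x y, (coxeterDiagram A).Walk x y → x ∈ C → y ∈ C := by
    intro x y p
    induction p with
    | nil => exact id
    | cons h p ih => exact fun hx => ih (hclosed _ hx _ h)
  have hsub : C ⊆ {s : B | ∀ t ∈ M, ¬ (coxeterDiagram A).Reachable t s} := by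
    rintro s hs t ht ⟨p⟩
    exact hCM (hreach s t p.reverse hs) ht
  exact not_finite_iff_infinite.mpr hCinf
    (Finite.of_injective _ (Subgroup.inclusion_injective (parabolic_mono cs hsub)))

theorem finite_of_hasFiniteVertexLinks [Finite B] (cs : CoxeterSystem A W) (M : Set B)
    (hM : Finite (parabolic cs {s : B | ∀ t ∈ M, ¬ (coxeterDiagram A).Reachable t s}))
    (hlink : HasFiniteVertexLinks cs M) : Finite (parabolic cs Mᶜ) := by
  by_contra hinf
  obtain ⟨C, hCM, hC, hCinf, a, ha, m, hm, ham⟩ :=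
    exists_connected_adjacent cs M hM (not_finite_iff_infinite.mp hinf)
  have hmM : m ∉ Mᶜ := fun h => h hm
  have hCpar := parabolic_mono cs hCM
  -- The edges from `x₀` to `u m x₀`, for `u ∈ W_C`, belong to the link of `x₀`.
  refine not_finite_iff_infinite.mpr hCinf (finite_parabolic_of_finite_range cs hC ha
    (fun h => hmM (hCM h)) ham (fun u => faceSet cs M (u : W) {m}) ?_ ?_)
  · refine ((hlink (chamberVertex cs M 1)).image Subtype.val).subset ?_
    rintro _ ⟨u, rfl⟩
    refine ⟨⟨faceSet cs M (u : W) {m}, Or.inr ⟨u, {m}, rfl⟩⟩, ⟨?_, le_top⟩, rfl⟩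
    intro v hv
    rw [Set.mem_singleton_iff.mp hv]
    refine ⟨1, one_mem _, ?_⟩
    rw [mul_one, chamberVertex_eq_iff, inv_one, one_mul]
    exact hCpar u.2
  · intro u v huv
    have hdi : ∀ x ∈ parabolic cs {m}, x = 1 ∨ x = cs.simple m := by
      intro x hx
      refine parabolic_induction_right cs hx (p := fun x => x = 1 ∨ x = cs.simple m)
        (Or.inl rfl) fun x _ s hs ih => ?_
      rw [Set.mem_singleton_iff.mp hs]
      rcases ih with rfl | rfl <;> simp
    have hmem : chamberVertex cs M ((v : W) * cs.simple m) ∈ faceSet cs M (u : W) {m} := by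
      have huv' : faceSet cs M (u : W) {m} = faceSet cs M (v : W) {m} := huv
      rw [huv']
      exact ⟨cs.simple m, simple_mem_parabolic cs rfl, rfl⟩
    obtain ⟨x, hx, hxv⟩ := hmem
    rw [chamberVertex_eq_iff] at hxv
    rcases hdi x hx with rfl | rfl
    · -- The vertex `v m x₀` differs from `x₀`, because `m` is not in `W_{S ∖ M}`.
      refine (hmM ((simple_mem_parabolic_iff cs).mp ?_)).elim
      have := mul_mem (mul_mem hxv (inv_mem (hCpar u.2))) (hCpar v.2)
      rw [← inv_mem_iff]
      convert this using 1
      group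
    · refine commute_of_conj_mem_parabolic cs hmM (hCpar (u⁻¹ * v).2) ?_
      have := inv_mem hxv
      simp only [Subgroup.coe_mul, Subgroup.coe_inv]
      convert this using 1
      simp only [mul_inv_rev, inv_inv, cs.inv_simple, mul_assoc]

open scoped Pointwise in
open Classical in
theorem wordProd_mem_pow_properParabolics (cs : CoxeterSystem A W) {M C : Set B} (hCM : C ⊆ Mᶜ)
    (hC : C.Nonempty) {m : B} (hm : m ∈ M) {ω : List B} (hω : ∀ s ∈ ω, s ∈ insert m C) {n : ℕ}
    (hn : ω.countP (· ∈ M) ≤ n) :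
    cs.wordProd ω ∈ properParabolics cs (insert m C) ^ (2 * n + 1) := by
  have hmC : m ∉ C := fun h => hCM h hm
  have hCQ : (parabolic cs C : Set W) ⊆ properParabolics cs (insert m C) := fun x hx =>
    ⟨m, Set.mem_insert m C, by rwa [Set.insert_sdiff_self_of_notMem hmC]⟩
  have hmQ : cs.simple m ∈ properParabolics cs (insert m C) := by
    obtain ⟨c, hc⟩ := hC
    exact ⟨c, Set.mem_insert_of_mem m hc, simple_mem_parabolic cs
      ⟨Set.mem_insert m C, fun h => hmC ((Set.mem_singleton_iff.mp h).symm ▸ hc)⟩⟩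
  have key : ∃ h ∈ parabolic cs C,
      h⁻¹ * cs.wordProd ω ∈ properParabolics cs (insert m C) ^ (2 * ω.countP (· ∈ M)) := by
    clear hn
    induction ω with
    | nil => exact ⟨1, one_mem _, by simp⟩
    | cons s ω ih =>
      obtain ⟨h, hh, hmem⟩ := ih fun t ht => hω t (List.mem_cons_of_mem s ht)
      rcases hω s List.mem_cons_self with rfl | hs
      · refine ⟨1, one_mem _, ?_⟩
        rw [List.countP_cons_of_pos (by simpa using hm), mul_add, mul_one, add_comm, pow_add,
          pow_two, cs.wordProd_cons]
        have := Set.mul_mem_mul (Set.mul_mem_mul hmQ (hCQ hh)) hmem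
        convert this using 1
        simp [mul_assoc]
      · refine ⟨cs.simple s * h, mul_mem (simple_mem_parabolic cs hs) hh, ?_⟩
        rw [List.countP_cons_of_neg (by simpa using hCM hs), cs.wordProd_cons, mul_inv_rev,
          cs.inv_simple, mul_assoc, cs.simple_mul_simple_cancel_left]
        exact hmem
  obtain ⟨h, hh, hmem⟩ := key
  refine pow_properParabolics_mono cs (Set.insert_nonempty m C)
    (by omega : 2 * ω.countP (· ∈ M) + 1 ≤ _) ?_
  rw [pow_succ']
  have := Set.mul_mem_mul (hCQ hh) hmem
  rwa [mul_inv_cancel_left] at this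

open scoped Pointwise in
/-- A quasi-isometry of the skeleton to the locally finite Cayley graph covers every ball of the
skeleton by finitely many sets of a fixed diameter. This fails for a sphere around `x₀` on which an
infinite irreducible `W_C ≤ W_{S ∖ M}` acts. -/
theorem finite_of_quasiIsometric [Finite B] (cs : CoxeterSystem A W) (M : Set B)
    (hM : Finite (parabolic cs {s : B | ∀ t ∈ M, ¬ (coxeterDiagram A).Reachable t s}))
    (hqi : QuasiIsometric (skeleton cs M) (cayleyGraph cs)) : Finite (parabolic cs Mᶜ) := by
  classical
  by_contra hinf
  obtain ⟨C, hCM, hC, hCinf, a, ha, m, hm, ham⟩ :=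
    exists_connected_adjacent cs M hM (not_finite_iff_infinite.mp hinf)
  have hmC : m ∉ C := fun h => hCM h hm
  have hCne : C.Nonempty := ⟨a, ha⟩
  obtain ⟨φ, α, β, -, hα, hβ, -, hφ, -⟩ := hqi
  set R := ⌊β⌋₊ with hR
  have hclose : ∀ v v', φ v = φ v' → (skeleton cs M).dist v v' ≤ R := by
    intro v v' h
    have h1 := (hφ v v').1
    rw [h, SimpleGraph.dist_self, ← mul_sub, inv_mul_le_iff₀ (by linarith)] at h1
    exact Nat.le_floor (by push_cast at h1; linarith)
  -- A vertex `w x₀` too far from `x₀` for a path of length `R` from `w x₀` to `u w x₀` to reach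
  -- `x₀`.
  obtain ⟨w, hw, hwQ⟩ := Set.not_subset.mp (not_parabolic_insert_subset_pow cs hC hCinf ha hmC ham
    (not_parabolic_subset_pow cs hC hCinf) (2 * R + 1))
  obtain ⟨N, hN⟩ := mem_pow_of_conj_mem_pow cs hC hCinf ha hmC ham hw (2 * R + 1)
  have hfin : ((fun u : W => φ (chamberVertex cs M (u * w))) '' parabolic cs C).Finite := by
    set r := (skeleton cs M).dist (chamberVertex cs M 1) (chamberVertex cs M w) with hr
    refine (finite_cayleyGraph_ball cs (φ (chamberVertex cs M 1)) ⌊α * r + β⌋₊).subset ?_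
    rintro _ ⟨u, hu, rfl⟩
    have h1 := (hφ (chamberVertex cs M 1) (chamberVertex cs M (u * w))).2
    have h2 : (skeleton cs M).dist (chamberVertex cs M 1) (chamberVertex cs M (u * w)) ≤ r := by
      have h3 := skeleton_dist_smul_le cs M u (chamberVertex cs M 1) (chamberVertex cs M w)
      have h4 : u • chamberVertex cs M 1 = chamberVertex cs M 1 := by
        change chamberVertex cs M (u * 1) = _
        rw [chamberVertex_eq_iff, mul_one, mul_one]
        exact inv_mem (parabolic_mono cs hCM hu)
      rwa [h4] at h3
    refine Nat.le_floor (h1.trans ?_)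
    have h3 : ((skeleton cs M).dist (chamberVertex cs M 1) (chamberVertex cs M (u * w)) : ℝ) ≤ r :=
      by exact_mod_cast h2
    gcongr
  have hpre : ∀ y ∈ (fun u : W => φ (chamberVertex cs M (u * w))) '' parabolic cs C,
      ∃ x ∈ parabolic cs C, φ (chamberVertex cs M (x * w)) = y := fun y hy => hy
  choose! pre hpreC hpre using hpre
  have hpow : ∀ x ∈ parabolic cs C, ∃ n, x ∈ properParabolics cs C ^ n := fun x hx =>
    exists_mem_pow_properParabolics cs hCinf hx
  choose! e he using hpow
  obtain ⟨n₀, hn₀⟩ := (hfin.image fun y => e (pre y)).bddAbove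
  refine not_parabolic_subset_pow cs hC hCinf (n₀ + N) fun u hu => ?_
  set y := φ (chamberVertex cs M (u * w)) with hy
  have hyim : y ∈ (fun u : W => φ (chamberVertex cs M (u * w))) '' parabolic cs C := ⟨u, hu, rfl⟩
  set f := pre y with hf
  have hfC : f ∈ parabolic cs C := hpreC y hyim
  have hfn : f ∈ properParabolics cs C ^ n₀ :=
    pow_properParabolics_mono cs hCne (hn₀ ⟨y, hyim, rfl⟩) (he f hfC)
  have hvC : f⁻¹ * u ∈ parabolic cs C := mul_mem (inv_mem hfC) hu
  obtain ⟨ω, hω, hcount⟩ := exists_word_of_skeleton_dist cs M (f * w) (u * w)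
  have hω' : cs.wordProd ω = w⁻¹ * (f⁻¹ * u) * w := by rw [hω]; group
  have hCJ := parabolic_mono cs (Set.subset_insert m C)
  obtain ⟨ω', hsub, hJ, hprod⟩ := exists_sublist_of_mem_parabolic cs (J := insert m C) _ ω rfl
    (by rw [hω']; exact mul_mem (mul_mem (inv_mem hw) (hCJ hvC)) hw)
  have hle : ω'.countP (· ∈ M) ≤ R :=
    (hsub.countP_le).trans (hcount.trans (hclose _ _ ((hpre y hyim).trans hy)))
  have hmem := wordProd_mem_pow_properParabolics cs hCM hCne hm hJ hle
  rw [hprod, hω'] at hmem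
  rcases hN _ hvC hmem with h | ⟨i, j, hij, h, -⟩
  · rw [pow_add]
    have := Set.mul_mem_mul hfn h
    rwa [mul_inv_cancel_left] at this
  · exact (hwQ (pow_properParabolics_mono cs (Set.insert_nonempty m C) (by omega) h)).elim

end Wythoff

theorem mainTheorem6 {B W : Type*} [Finite B] [Group W] {A : CoxeterMatrix B}
    (cs : CoxeterSystem A W) (M : Set B)
    (hM : Finite (Wythoff.parabolic cs
      {s : B | ∀ t ∈ M, ¬ (Wythoff.coxeterDiagram A).Reachable t s})) :
    (Wythoff.QuasiIsometric (Wythoff.skeleton cs M) (Wythoff.cayleyGraph cs) ↔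
      Wythoff.HasFiniteVertexLinks cs M) ∧
    (Wythoff.HasFiniteVertexLinks cs M →
      Function.Surjective (Wythoff.chamberVertex cs M) ∧
      (∀ g w : W, Wythoff.chamberVertex cs M (g * w) = g • Wythoff.chamberVertex cs M w) ∧
      (∀ w w' : W, (Wythoff.skeleton cs M).dist
          (Wythoff.chamberVertex cs M w) (Wythoff.chamberVertex cs M w') ≤
        (Wythoff.cayleyGraph cs).dist w w') ∧
      Wythoff.IsQuasiIsometry (Wythoff.cayleyGraph cs) (Wythoff.skeleton cs M)
        (Wythoff.chamberVertex cs M) ∧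
      ∃ w₀ ∈ Wythoff.parabolic cs Mᶜ,
        (∀ u ∈ Wythoff.parabolic cs Mᶜ, cs.length u ≤ cs.length w₀) ∧
        ∀ w w' : W, (Wythoff.cayleyGraph cs).dist w w' ≤
          (cs.length w₀ + 1) * (Wythoff.skeleton cs M).dist
            (Wythoff.chamberVertex cs M w) (Wythoff.chamberVertex cs M w') + cs.length w₀) := by
  refine ⟨⟨fun h => ?_, fun h => ?_⟩, fun h => ?_⟩
  · exact Wythoff.hasFiniteVertexLinks_of_finite cs M (Wythoff.finite_of_quasiIsometric cs M hM h)
  · exact Wythoff.quasiIsometric_skeleton_cayleyGraph cs M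
      (Wythoff.finite_of_hasFiniteVertexLinks cs M hM h)
  · have hfin := Wythoff.finite_of_hasFiniteVertexLinks cs M hM h
    obtain ⟨w₀, hw₀, hmax⟩ := Wythoff.exists_length_maximal cs Mᶜ hfin
    exact ⟨QuotientGroup.mk_surjective, fun _ _ => rfl,
      Wythoff.skeleton_dist_le_cayleyGraph_dist cs M,
      Wythoff.isQuasiIsometry_chamberVertex cs M hfin, w₀, hw₀, hmax,
      Wythoff.cayleyGraph_dist_le_skeleton_dist cs M hmax⟩
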